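/- **Setting.** Let $12345$ be a 4-simplex; its edges $ij$ ($i<j$) and 2-faces $ijk$ ($i<j<k$) are oriented by the increasing order of vertices. Attach a generator $x_t$ of the complex Grassmann algebra to each tetrahedron $t$, and let $\partial_t$ be the left derivative in $x_t$. On the 10-dimensional space $\mathcal V$ of operators $d=\sum_t(\beta_t\partial_t+\gamma_t x_t)$ use the scalar product $\langle d,d'\rangle=dd'+d'd=\sum_t(\beta_t\gamma'_t+\beta'_t\gamma_t)$. A *quasi-Gaussian weight* corresponding to a maximal isotropic subspace $V\subset\mathcal V$ is a nonzero element $\mathcal W$ of the Grassmann algebra annihilated by $V$. An *edge operator* for an edge $b$ is an element of $V$ with $\beta_t=\gamma_t=0$ for all tetrahedra $t\not\supset b$. A *normalized family* consists of nonzero operators $d_b$, one for each edge $b$, such that $d_b$ spans the space of edge operators for $b$, and $\sum_{b}\alpha_b d_b=0$ for every coboundary $\alpha_{ij}=f_j-f_i$. A nonzero 2-cocycle $\omega$ is a *$\mathcal W$-cocycle* if, for a normalized family, $\omega=\delta\nu$, i.e. $\omega_{ijk}=\nu_{jk}-\nu_{ik}+\nu_{ij}$, where the 1-cochain $\nu$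 satisfies $\sum_b\nu_b d_b=0$ and, together with the coboundaries, spans the space of all 1-cochains $\alpha$ with $\sum_b\alpha_b d_b=0$. For numbers $\varphi_{ijk}\in\mathbb C$, $1\le i<j<k\le5$, put $$\Phi=\sum_{ijk}\epsilon_{lijkm}\,\varphi_{ijk}\,x_{\{ijkl\}}x_{\{ijkm\}},$$ where $l<m$ are the two vertices not in $ijk$, $\epsilon_{lijkm}$ is the sign of the permutation, and $\{\dots\}$ means increasing order; and let $F$ be the skew-symmetric $5\times5$ matrix with $F_{lm}=\epsilon_{lijkm}\varphi_{ijk}$ for $l<m$ (that is, $F_{12}=-\varphi_{345}$, $F_{13}=\varphi_{245}$, $F_{14}=-\varphi_{235}$, and so on). Let $\operatorname{Im}\tau>0$, and let $\mathrm{sn},\mathrm{cn},\mathrm{dn}$ be the Jacobi elliptic functions of modulus $\kappa=\theta_2(0|\tau)^2/\theta_3(0|\tau)^2$ (every $\kappa\in\mathbb C\setminus\{0,1,-1\}$ is of this form, and the functions depend only on $\kappa$). **Theorem.** Let $x_1,\dots,x_5\in\mathbb C$ be such that, for all $i\ne j$, the number $x_i-x_j$ is neither a pole nor a zero of $\mathrm{sn}$.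 Then $\mathrm{sn},\mathrm{cn},\mathrm{dn}$ are finite, and $\mathrm{cn}$ and $\mathrm{dn}$ do not vanish, at all points $(x_i-x_j)/2$, and there are $\varphi_{ijk}\in\mathbb C$ for which $$F_{ij}=\frac{\mathrm{sn}}{\mathrm{cn}\,\mathrm{dn}}\Bigl(\frac{x_i-x_j}{2}\Bigr)\qquad\text{for all } i,j,$$ and $\mathcal W=\exp\Phi$ is a quasi-Gaussian weight for which $$\omega_{ijk}=\mathrm{sn}(x_i-x_j)\,\mathrm{sn}(x_i-x_k)\,\mathrm{sn}(x_j-x_k)$$ is a $\mathcal W$-cocycle. -/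

import Mathlib

noncomputable section

namespace EllipticWeight

/-! ### Jacobi theta functions and Jacobi elliptic functions

`jacobiTheta₂ v τ = ∑ₙ exp (2πi n v + πi n² τ)`. The four classical theta functions are written
in the normalization with (quasi-)periods `1` and `τ` in the variable `v`. -/

/-- `θ₁(v|τ) = 2 q^{1/4} sin(πv) - 2 q^{9/4} sin(3πv) + …`, where `q = exp(πiτ)`. -/
def theta1 (τ v : ℂ) : ℂ :=
  -Complex.I * Complex.exp (Real.pi * Complex.I * (τ / 4 + v)) * jacobiTheta₂ (v + τ / 2 + 1 / 2) τ

/-- `θ₂(v|τ) = 2 q^{1/4} cos(πv) + 2 q^{9/4} cos(3πv) + …`. -/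
def theta2 (τ v : ℂ) : ℂ :=
  Complex.exp (Real.pi * Complex.I * (τ / 4 + v)) * jacobiTheta₂ (v + τ / 2) τ

/-- `θ₃(v|τ) = 1 + 2 q cos(2πv) + 2 q⁴ cos(4πv) + …`. -/
def theta3 (τ v : ℂ) : ℂ := jacobiTheta₂ v τ

/-- `θ₄(v|τ) = 1 - 2 q cos(2πv) + 2 q⁴ cos(4πv) - …`. -/
def theta4 (τ v : ℂ) : ℂ := jacobiTheta₂ (v + 1 / 2) τ

/-- The modulus `κ = θ₂(0|τ)² / θ₃(0|τ)²`. When `τ` runs over the upper half-plane, `κ` runs over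
all of `ℂ ∖ {0, 1, -1}`, and the functions `sn`, `cn`, `dn` below depend on `τ` only through `κ`. -/
def modulus (τ : ℂ) : ℂ := theta2 τ 0 ^ 2 / theta3 τ 0 ^ 2

/-- The theta-function argument `v = u / (2K) = u / (π θ₃(0|τ)²)` that corresponds to `u`. -/
def thetaArg (τ u : ℂ) : ℂ := u / (Real.pi * theta3 τ 0 ^ 2)

/-- The point `u` is not a pole of the Jacobi elliptic functions `sn`, `cn`, `dn` (they have the
same poles, which are the zeros of the denominator `θ₄`). -/
def IsRegularPoint (τ u : ℂ) : Prop := theta4 τ (thetaArg τ u) ≠ 0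

/-- Jacobi's elliptic sine `sn(u, κ)` with `κ = modulus τ`. -/
def sn (τ u : ℂ) : ℂ :=
  theta3 τ 0 / theta2 τ 0 * (theta1 τ (thetaArg τ u) / theta4 τ (thetaArg τ u))

/-- Jacobi's elliptic cosine `cn(u, κ)` with `κ = modulus τ`. -/
def cn (τ u : ℂ) : ℂ :=
  theta4 τ 0 / theta2 τ 0 * (theta2 τ (thetaArg τ u) / theta4 τ (thetaArg τ u))

/-- Jacobi's delta amplitude `dn(u, κ)` with `κ = modulus τ`. -/
def dn (τ u : ℂ) : ℂ :=
  theta4 τ 0 / theta3 τ 0 * (theta3 τ (thetaArg τ u) / theta4 τ (thetaArg τ u))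

/-! ### The 4-simplex and its cochains

The vertices `1, …, 5` of the 4-simplex are `0, …, 4 : Fin 5`. Edges and 2-faces are increasing
sequences of vertices; this also fixes their orientations. A 3-face (tetrahedron) is labelled by
the vertex *opposite* to it, so that, in the order of labels, the tetrahedra are
`2345, 1345, 1245, 1235, 1234`. -/

/-- Edges `ij`, `i < j`. -/
abbrev Edge : Type := {b : Fin 5 × Fin 5 // b.1 < b.2}

/-- 2-faces `ijk`, `i < j < k`. -/
abbrev Face : Type := {s : Fin 5 × Fin 5 × Fin 5 // s.1 < s.2.1 ∧ s.2.1 < s.2.2}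

/-- The edge `ij`. -/
def edge (i j : Fin 5) (h : i < j := by decide) : Edge := ⟨(i, j), h⟩

/-- The 2-face `ijk`. -/
def face (i j k : Fin 5) (hij : i < j := by decide) (hjk : j < k := by decide) : Face :=
  ⟨(i, j, k), hij, hjk⟩

/-- Coboundary of a 0-cochain: `(δf)_{ij} = f_j - f_i`. -/
def coboundary0 (f : Fin 5 → ℂ) : Edge → ℂ := fun b => f b.1.2 - f b.1.1

/-- Coboundary of a 1-cochain: `(δν)_{ijk} = ν_{jk} - ν_{ik} + ν_{ij}`. -/
def coboundary1 (ν : Edge → ℂ) : Face → ℂ := fun s =>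
  ν (edge s.1.2.1 s.1.2.2 s.2.2) - ν (edge s.1.1 s.1.2.2 (s.2.1.trans s.2.2))
    + ν (edge s.1.1 s.1.2.1 s.2.1)

/-! ### Grassmann algebra and first order operators -/

/-- The Grassmann algebra over `ℂ` with five generators, one for each tetrahedron. -/
abbrev Grassmann : Type := ExteriorAlgebra ℂ (Fin 5 → ℂ)

/-- The Grassmann variable `x_t`, where `t` is the tetrahedron opposite to the vertex `t`. -/
def gvar (t : Fin 5) : Grassmann := ExteriorAlgebra.ι ℂ (Pi.single t 1)

/-- The left derivative `∂_t`, that is, the antiderivation of the Grassmann algebra with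
`∂_t x_t = 1` and `∂_t x_s = 0` for `s ≠ t`. -/
def leftDeriv (t : Fin 5) : Grassmann →ₗ[ℂ] Grassmann :=
  CliffordAlgebra.contractLeft (LinearMap.proj t : (Fin 5 → ℂ) →ₗ[ℂ] ℂ)

/-- The ten-dimensional space of operators `∑_t (β_t ∂_t + γ_t x_t)`, with elements written as
pairs `(β, γ)` of coefficient vectors. -/
abbrev OpSpace : Type := (Fin 5 → ℂ) × (Fin 5 → ℂ)

/-- The action of `d = ∑_t (β_t ∂_t + γ_t x_t)` on the Grassmann algebra; `x_t` acts by left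
multiplication. -/
def act (d : OpSpace) : Grassmann →ₗ[ℂ] Grassmann :=
  ∑ t, (d.1 t • leftDeriv t + d.2 t • LinearMap.mulLeft ℂ (gvar t))

/-- The scalar product (anticommutator) of two operators. -/
def scalarProduct (d d' : OpSpace) : ℂ := ∑ t, (d.1 t * d'.2 t + d'.1 t * d.2 t)

/-- Isotropic subspaces: the scalar product vanishes identically on them. -/
def IsIsotropic (V : Submodule ℂ OpSpace) : Prop :=
  ∀ d ∈ V, ∀ d' ∈ V, scalarProduct d d' = 0

/-- `W` is the quasi-Gaussian 4-simplex weight corresponding to `V`: `V` is a maximal (with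
respect to inclusion) isotropic subspace, and `W` is a nonzero element annihilated by `V`. -/
structure IsQuasiGaussianWeight (V : Submodule ℂ OpSpace) (W : Grassmann) : Prop where
  maximal_isotropic : Maximal IsIsotropic V
  ne_zero : W ≠ 0
  annihilated : ∀ d ∈ V, act d W = 0

/-! ### Edge operators and the 2-cocycle of a weight -/

/-- The edge operators for an edge `b`: the elements of `V` with zero coefficients at `∂_t` and
`x_t` for each tetrahedron `t` not containing `b`, that is, opposite to one of the ends of `b`. -/
def edgeOperators (V : Submodule ℂ OpSpace) (b : Edge) : Submodule ℂ OpSpace where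
  carrier := {d | d ∈ V ∧ ∀ t, (t = b.1.1 ∨ t = b.1.2) → d.1 t = 0 ∧ d.2 t = 0}
  zero_mem' := ⟨V.zero_mem, fun _ _ => ⟨rfl, rfl⟩⟩
  add_mem' := by
    rintro d d' ⟨h, h0⟩ ⟨h', h0'⟩
    exact ⟨V.add_mem h h', fun t ht => by simp [h0 t ht, h0' t ht]⟩
  smul_mem' := by
    rintro c d ⟨h, h0⟩
    exact ⟨V.smul_mem c h, fun t ht => by simp [h0 t ht]⟩

/-- The operator that corresponds to a 1-cochain `α`, for a given family of edge operators. -/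
def cochainOperator (d : Edge → OpSpace) (α : Edge → ℂ) : OpSpace := ∑ b, α b • d b

/-- A normalized family of edge operators for `V`: for each edge `b`, the operator `d b` is a
nonzero one that spans the space of edge operators for `b`, and the operators that correspond to
1-coboundaries vanish. -/
structure IsNormalizedFamily (V : Submodule ℂ OpSpace) (d : Edge → OpSpace) : Prop where
  span_eq : ∀ b, edgeOperators V b = Submodule.span ℂ {d b}
  ne_zero : ∀ b, d b ≠ 0
  coboundary : ∀ f : Fin 5 → ℂ, cochainOperator d (coboundary0 f) = 0

/-- `ω` is a `W`-cocycle: a nonvanishing 2-cocycle of the form `ω = δν`, where `ν` is a 1-cochain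
whose operator, for a normalized family of edge operators of the weight `W`, vanishes, and which
spans, together with the coboundaries, all the 1-cochains with this property. -/
def IsCocycleOfWeight (W : Grassmann) (ω : Face → ℂ) : Prop :=
  ω ≠ 0 ∧ ∃ (V : Submodule ℂ OpSpace) (d : Edge → OpSpace) (ν : Edge → ℂ),
    IsQuasiGaussianWeight V W ∧ IsNormalizedFamily V d ∧ coboundary1 ν = ω ∧
      ∀ α : Edge → ℂ, cochainOperator d α = 0 ↔
        ∃ (f : Fin 5 → ℂ) (c : ℂ), α = coboundary0 f + c • ν

/-! ### Gaussian weights and the elliptic data -/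

/-- The sign of the permutation between a sequence of five vertices and the increasing one, as
the product of the signs of the differences over all pairs of positions (so it is zero when the
entries are not all different). -/
def permSign (v : Fin 5 → Fin 5) : ℤ :=
  ∏ p : Edge, Int.sign (((v p.1.2 : ℕ) : ℤ) - ((v p.1.1 : ℕ) : ℤ))

/-- The quadratic form `Φ = ∑_{ijk} ε_{lijkm} φ_{ijk} x_{ijkl} x_{ijkm}`, where `l < m` are the two
vertices not in `ijk`. The inner sum has just one term; the tetrahedron `ijkl` is opposite to
`m`, and `ijkm` is opposite to `l`. -/
def quadraticForm (φ : Face → ℂ) : Grassmann :=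
  ∑ s : Face, ∑ e : Edge with
      e.1.1 ∉ ({s.1.1, s.1.2.1, s.1.2.2} : Finset (Fin 5)) ∧
        e.1.2 ∉ ({s.1.1, s.1.2.1, s.1.2.2} : Finset (Fin 5)),
    ((permSign ![e.1.1, s.1.1, s.1.2.1, s.1.2.2, e.1.2] : ℂ) * φ s) •
      (gvar e.1.2 * gvar e.1.1)

/-- The Grassmann–Gaussian exponent `exp Φ` (the Taylor series is a finite sum, as `Φ` is
nilpotent). -/
def gaussianWeight (φ : Face → ℂ) : Grassmann := IsNilpotent.exp (quadraticForm φ)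

/-- The skew-symmetric `5 × 5` matrix `F` made of the quantities `φ_{ijk}`; rows and columns
correspond to the tetrahedra `2345, 1345, 1245, 1235, 1234`. -/
def weightMatrix (φ : Face → ℂ) : Matrix (Fin 5) (Fin 5) ℂ :=
  !![0, -φ (face 2 3 4), φ (face 1 3 4), -φ (face 1 2 4), φ (face 1 2 3);
     φ (face 2 3 4), 0, -φ (face 0 3 4), φ (face 0 2 4), -φ (face 0 2 3);
     -φ (face 1 3 4), φ (face 0 3 4), 0, -φ (face 0 1 4), φ (face 0 1 3);
     φ (face 1 2 4), -φ (face 0 2 4), φ (face 0 1 4), 0, -φ (face 0 1 2);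
     -φ (face 1 2 3), φ (face 0 2 3), -φ (face 0 1 3), φ (face 0 1 2), 0]

/-- The 2-cochain `ω_{ijk} = sn(x_i - x_j) sn(x_i - x_k) sn(x_j - x_k)`. -/
def ellipticCocycle (τ : ℂ) (x : Fin 5 → ℂ) : Face → ℂ := fun s =>
  sn τ (x s.1.1 - x s.1.2.1) * sn τ (x s.1.1 - x s.1.2.2) * sn τ (x s.1.2.1 - x s.1.2.2)

end EllipticWeight

end

noncomputable section

namespace EllipticWeight

open Complex

/-! ### Theta function identities -/

/-! The annihilator of `exp Φ` is the graph of `F`: the operators with coefficients `β` at the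
derivatives and `βF` at the variables. For an edge `ij` the edge operators have `β` supported on the
three other indices and orthogonal there to rows `i` and `j` of `F`, so `β` is a multiple of the
cross product of these rows. It remains to scale the cross products by factors `p i j` and to find
all linear relations between them.

The right factors are `p = 1 / sn`. Up to a constant, `sn / (cn dn)` at half arguments is `θ₁ / θ₂`
with period `τ / 2`, and products of two such theta functions are bilinear in those with period `τ`
(`theta2_half_mul_theta2_half` and its shifts). This gives the two identities in `EdgeData`. The
three-point relation, combined over three pairs, yields `vertex_relation`, which says that
coboundaries give zero operators. The Pfaffian relation makes every `4 × 4` Pfaffian of `F` nonzero;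
together with the vertex relations it implies that `ω` is a cocycle and that no cross product
vanishes.

The cone `ν` over `ω` from a vertex satisfies `δν = ω` and also gives the zero operator. Since the
Pfaffians are nonzero, the edge operators span the 5-dimensional `V`, so their relations form a
space of dimension `10 - 5 = 5`. The coboundaries (dimension 4) and `ν` therefore account for all of
them. -/

/-- Pairs of integers, according to the parity of their sum. -/
def parityEquiv : (ℤ × ℤ) ⊕ (ℤ × ℤ) ≃ ℤ × ℤ where
  toFun := Sum.elim (fun p => (p.1 + p.2, p.1 - p.2)) (fun p => (p.1 + p.2 + 1, p.1 - p.2))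
  invFun p := if (p.1 + p.2) % 2 = 0 then Sum.inl ((p.1 + p.2) / 2, (p.1 - p.2) / 2)
    else Sum.inr ((p.1 + p.2 - 1) / 2, (p.1 - p.2 - 1) / 2)
  left_inv := by
    rintro (⟨a, b⟩ | ⟨a, b⟩)
    · have h : (a + b + (a - b)) % 2 = 0 := by omega
      simp only [Sum.elim_inl, h, if_true, Sum.inl.injEq, Prod.mk.injEq]
      omega
    · have h : ¬ (a + b + 1 + (a - b)) % 2 = 0 := by omega
      simp only [Sum.elim_inr, h, if_false, Sum.inr.injEq, Prod.mk.injEq]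
      omega
  right_inv := by
    rintro ⟨m, n⟩
    by_cases h : (m + n) % 2 = 0
    · simp only [h, if_true, Sum.elim_inl, Prod.mk.injEq]
      omega
    · simp only [h, if_false, Sum.elim_inr, Prod.mk.injEq]
      omega

lemma half_im_pos {τ : ℂ} (hτ : 0 < τ.im) : 0 < (τ / 2).im := by
  have : (τ / 2).im = τ.im / 2 := by simp
  rw [this]; positivity

lemma theta2_eq_tsum (τ v : ℂ) : theta2 τ v =
    ∑' n : ℤ, cexp (Real.pi * I * (τ / 4 + v)) * jacobiTheta₂_term n (v + τ / 2) τ := by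
  rw [theta2, jacobiTheta₂, tsum_mul_left]

/-- In the double series put `m = a + b`, `n = a - b` when `m + n` is even, and `m = a + b + 1`, `n
= a - b` when it is odd. The quadratic exponents separate; the even part gives the `θ₃` product and
the odd part the `θ₂` product. -/
lemma jacobiTheta₂_half_mul {τ : ℂ} (hτ : 0 < τ.im) (x y : ℂ) :
    jacobiTheta₂ x (τ / 2) * jacobiTheta₂ y (τ / 2) =
      theta3 τ (x + y) * theta3 τ (x - y) + theta2 τ (x + y) * theta2 τ (x - y) := by
  have hn : ∀ (z : ℂ) {σ : ℂ}, 0 < σ.im → Summable fun n : ℤ => ‖jacobiTheta₂_term n z σ‖ :=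
    fun z σ hσ => ((summable_jacobiTheta₂_term_iff z σ).2 hσ).norm
  have h2 := half_im_pos hτ
  have hn2 : ∀ v : ℂ, Summable fun n : ℤ =>
      ‖cexp (Real.pi * I * (τ / 4 + v)) * jacobiTheta₂_term n (v + τ / 2) τ‖ := fun v =>
    (((summable_jacobiTheta₂_term_iff (v + τ / 2) τ).2 hτ).mul_left _).norm
  have e1 : ∀ p : ℤ × ℤ, jacobiTheta₂_term (p.1 + p.2) x (τ / 2) *
      jacobiTheta₂_term (p.1 - p.2) y (τ / 2) =
      jacobiTheta₂_term p.1 (x + y) τ * jacobiTheta₂_term p.2 (x - y) τ := fun p => by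
    simp only [jacobiTheta₂_term, ← Complex.exp_add]
    congr 1
    push_cast
    ring
  have e2 : ∀ p : ℤ × ℤ, jacobiTheta₂_term (p.1 + p.2 + 1) x (τ / 2) *
      jacobiTheta₂_term (p.1 - p.2) y (τ / 2) =
      (cexp (Real.pi * I * (τ / 4 + (x + y))) * jacobiTheta₂_term p.1 (x + y + τ / 2) τ) *
      (cexp (Real.pi * I * (τ / 4 + (x - y))) * jacobiTheta₂_term p.2 (x - y + τ / 2) τ) :=
    fun p => by
    simp only [jacobiTheta₂_term, ← Complex.exp_add]
    congr 1
    push_cast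
    ring
  have hs := summable_mul_of_summable_norm (hn x h2) (hn y h2)
  have hs' := parityEquiv.summable_iff.2 hs
  have hl := hs'.comp_injective Sum.inl_injective
  have hr := hs'.comp_injective Sum.inr_injective
  rw [theta2_eq_tsum, theta2_eq_tsum, theta3, theta3]
  simp only [jacobiTheta₂]
  rw [tsum_mul_tsum_of_summable_norm (hn x h2) (hn y h2),
    tsum_mul_tsum_of_summable_norm (hn (x + y) hτ) (hn (x - y) hτ),
    tsum_mul_tsum_of_summable_norm (hn2 (x + y)) (hn2 (x - y)), ← parityEquiv.tsum_eq]
  refine (Summable.tsum_sum hl hr).trans ?_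
  congr 1
  · exact tsum_congr e1
  · exact tsum_congr e2

lemma exp_pi_mul_I_half : cexp (Real.pi * I * (1 / 2)) = I := by
  rw [show (Real.pi : ℂ) * I * (1 / 2) = Real.pi / 2 * I by ring, exp_pi_div_two_mul_I]

lemma theta2_add_half (τ v : ℂ) : theta2 τ (v + 1 / 2) = -theta1 τ v := by
  rw [theta2, theta1, ← add_assoc, mul_add, Complex.exp_add, exp_pi_mul_I_half,
    show v + 1 / 2 + τ / 2 = v + τ / 2 + 1 / 2 by ring]
  ring

lemma theta3_add_half (τ v : ℂ) : theta3 τ (v + 1 / 2) = theta4 τ v := rfl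

lemma theta2_add_one (τ v : ℂ) : theta2 τ (v + 1) = -theta2 τ v := by
  rw [theta2, theta2, ← add_assoc, mul_add, Complex.exp_add, mul_one, exp_pi_mul_I,
    show v + 1 + τ / 2 = v + τ / 2 + 1 by ring, jacobiTheta₂_add_left]
  ring

lemma theta3_add_one (τ v : ℂ) : theta3 τ (v + 1) = theta3 τ v := jacobiTheta₂_add_left v τ

lemma theta3_add_half_period (τ v : ℂ) :
    cexp (Real.pi * I * (τ / 4 + v)) * theta3 τ (v + τ / 2) = theta2 τ v := rfl

lemma theta2_add_half_period (τ v : ℂ) :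
    cexp (Real.pi * I * (τ / 4 + v)) * theta2 τ (v + τ / 2) = theta3 τ v := by
  rw [theta2, theta3, show v + τ / 2 + τ / 2 = v + τ by ring, jacobiTheta₂_add_left',
    ← mul_assoc, ← mul_assoc, ← Complex.exp_add, ← Complex.exp_add]
  rw [show Real.pi * I * (τ / 4 + v) + Real.pi * I * (τ / 4 + (v + τ / 2)) +
    -Real.pi * I * (τ + 2 * v) = 0 by ring, Complex.exp_zero, one_mul]

lemma theta2_neg (τ v : ℂ) : theta2 τ (-v) = theta2 τ v := by
  rw [theta2, theta2, ← jacobiTheta₂_neg_left, show v + τ / 2 = (v - τ / 2) + τ by ring,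
    jacobiTheta₂_add_left', show -(-v + τ / 2) = v - τ / 2 by ring, ← mul_assoc,
    ← Complex.exp_add]
  congr 2
  ring

lemma theta1_neg (τ v : ℂ) : theta1 τ (-v) = -theta1 τ v := by
  have h := theta2_add_half τ (-v)
  rw [show -v + 1 / 2 = -(v - 1 / 2) by ring, theta2_neg] at h
  have h2 := theta2_add_one τ (v - 1 / 2)
  rw [show v - 1 / 2 + 1 = v + 1 / 2 by ring, theta2_add_half] at h2
  linear_combination h - h2

lemma theta1_zero (τ : ℂ) : theta1 τ 0 = 0 := by
  have h := theta1_neg τ 0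
  rw [neg_zero] at h
  exact self_eq_neg.1 h

lemma theta4_neg (τ v : ℂ) : theta4 τ (-v) = theta4 τ v := by
  rw [theta4, theta4, ← jacobiTheta₂_neg_left, ← jacobiTheta₂_add_left,
    show -(-v + 1 / 2) + 1 = v + 1 / 2 by ring]

lemma theta2_half_mul_theta2_half {τ : ℂ} (hτ : 0 < τ.im) (x y : ℂ) :
    theta2 (τ / 2) x * theta2 (τ / 2) y =
      theta2 τ (x + y) * theta3 τ (x - y) + theta3 τ (x + y) * theta2 τ (x - y) := by
  -- Moving both arguments by `τ / 4` moves their sum by the half-period `τ / 2` and fixes their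
  -- difference, so `θ₂` and `θ₃` are exchanged in the sum only.
  have h := jacobiTheta₂_half_mul hτ (x + τ / 2 / 2) (y + τ / 2 / 2)
  rw [show x + τ / 2 / 2 + (y + τ / 2 / 2) = x + y + τ / 2 by ring,
    show x + τ / 2 / 2 - (y + τ / 2 / 2) = x - y by ring] at h
  have he : cexp (Real.pi * I * (τ / 2 / 4 + x)) * cexp (Real.pi * I * (τ / 2 / 4 + y)) =
      cexp (Real.pi * I * (τ / 4 + (x + y))) := by
    rw [← Complex.exp_add]; congr 1; ring
  rw [← theta3_add_half_period τ (x + y), ← theta2_add_half_period τ (x + y), theta2, theta2,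
    ← he]
  linear_combination cexp (Real.pi * I * (τ / 2 / 4 + x)) *
    cexp (Real.pi * I * (τ / 2 / 4 + y)) * h

lemma theta1_half_mul_theta2_half {τ : ℂ} (hτ : 0 < τ.im) (x y : ℂ) :
    theta1 (τ / 2) x * theta2 (τ / 2) y =
      theta1 τ (x + y) * theta4 τ (x - y) + theta4 τ (x + y) * theta1 τ (x - y) := by
  have h := theta2_half_mul_theta2_half hτ (x + 1 / 2) y
  rw [show x + 1 / 2 + y = x + y + 1 / 2 by ring, show x + 1 / 2 - y = x - y + 1 / 2 by ring] at h
  simp only [theta2_add_half, theta3_add_half] at h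
  linear_combination -h

lemma theta1_half_mul_theta1_half {τ : ℂ} (hτ : 0 < τ.im) (x y : ℂ) :
    theta1 (τ / 2) x * theta1 (τ / 2) y =
      theta3 τ (x + y) * theta2 τ (x - y) - theta2 τ (x + y) * theta3 τ (x - y) := by
  have h := theta2_half_mul_theta2_half hτ (x + 1 / 2) (y + 1 / 2)
  rw [show x + 1 / 2 + (y + 1 / 2) = x + y + 1 by ring,
    show x + 1 / 2 - (y + 1 / 2) = x - y by ring] at h
  simp only [theta2_add_half, theta3_add_one, theta2_add_one] at h
  linear_combination h

/-- `θ₁ / θ₂` with the period `τ / 2` gives, up to a constant, the entries of the weight matrix. -/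
lemma theta1_half_mul_const {τ : ℂ} (hτ : 0 < τ.im) (v : ℂ) :
    theta1 (τ / 2) v * theta2 (τ / 2) 0 = 2 * (theta1 τ v * theta4 τ v) := by
  rw [theta1_half_mul_theta2_half hτ, add_zero, sub_zero]; ring

lemma theta2_half_mul_const {τ : ℂ} (hτ : 0 < τ.im) (v : ℂ) :
    theta2 (τ / 2) v * theta2 (τ / 2) 0 = 2 * (theta2 τ v * theta3 τ v) := by
  rw [theta2_half_mul_theta2_half hτ, add_zero, sub_zero]; ring

lemma theta1_half_mul_theta2_half_self {τ : ℂ} (hτ : 0 < τ.im) (v : ℂ) :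
    theta1 (τ / 2) v * theta2 (τ / 2) v = theta1 τ (2 * v) * theta4 τ 0 := by
  rw [theta1_half_mul_theta2_half hτ, sub_self, theta1_zero, ← two_mul]; ring

lemma differentiable_theta2 {τ : ℂ} (hτ : 0 < τ.im) : Differentiable ℂ (theta2 τ) := by
  have h : Differentiable ℂ fun z => jacobiTheta₂ z τ := fun z =>
    differentiableAt_jacobiTheta₂_fst z hτ
  unfold theta2
  fun_prop

/-- If `θ₄(0)` vanished, the product of `θ₁` and `θ₂` with period `τ / 2` would vanish identically.
These are entire and translates of each other up to sign, so both would be zero, contradicting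
`θ₂(0|τ/2)² = 2 θ₂(0) θ₃(0)`. -/
lemma theta4_zero_ne_zero {τ : ℂ} (hτ : 0 < τ.im) (h2 : theta2 τ 0 ≠ 0) (h3 : theta3 τ 0 ≠ 0) :
    theta4 τ 0 ≠ 0 := by
  intro h4
  have hd := differentiable_theta2 (half_im_pos hτ)
  have hd' : Differentiable ℂ fun v => theta2 (τ / 2) (v + 1 / 2) := by fun_prop
  have hz : ∀ v ∈ Set.univ, theta2 (τ / 2) (v + 1 / 2) * theta2 (τ / 2) v = 0 := fun v _ => by
    rw [theta2_add_half, neg_mul, theta1_half_mul_theta2_half_self hτ, h4, mul_zero, neg_zero]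
  have h0 : ∀ v, theta2 (τ / 2) v = 0 := by
    rcases AnalyticOnNhd.eq_zero_or_eq_zero_of_mul_eq_zero
      (hd'.differentiableOn.analyticOnNhd isOpen_univ)
      (hd.differentiableOn.analyticOnNhd isOpen_univ) hz isPreconnected_univ with h | h
    · exact fun v => by simpa using h (v - 1 / 2) trivial
    · exact fun v => h v trivial
  have h := theta2_half_mul_const hτ 0
  rw [h0, zero_mul] at h
  exact mul_ne_zero two_ne_zero (mul_ne_zero h2 h3) h.symm

/-! ### The elliptic data of the theorem -/

/-- Antisymmetric quantities `F` and `p` on pairs of vertices with the algebraic relations that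
hold between `sn / (cn dn)` at half arguments and `1 / sn`. -/
structure EdgeData (F p : Fin 5 → Fin 5 → ℂ) (K c : ℂ) : Prop where
  F_swap : ∀ i j, F j i = -F i j
  p_swap : ∀ i j, p j i = -p i j
  F_ne : ∀ {i j}, i ≠ j → F i j ≠ 0
  p_ne : ∀ {i j}, i ≠ j → p i j ≠ 0
  c_ne : c ≠ 0
  three_point : ∀ {i j k}, i ≠ j → i ≠ k → j ≠ k →
    F j k * (p j i + p k i) * (F j i * F k i) = K * (F j i ^ 2 - F k i ^ 2)
  pfaffian : ∀ {i j k l}, i ≠ j → i ≠ k → i ≠ l → j ≠ k → j ≠ l → k ≠ l →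
    F i j * F k l - F i k * F j l + F i l * F j k =
      c * (F i j * F k l * (F i k * F j l) * (F i l * F j k))

/-- The odd function `θ₁ / θ₂` with the period `τ / 2`. -/
def halfSc (τ v : ℂ) : ℂ := theta1 (τ / 2) v / theta2 (τ / 2) v

lemma halfSc_neg (τ v : ℂ) : halfSc τ (-v) = -halfSc τ v := by
  rw [halfSc, halfSc, theta1_neg, theta2_neg, neg_div]

lemma theta1_half_ne_zero {τ : ℂ} (hτ : 0 < τ.im) {v : ℂ} (h4 : theta4 τ 0 ≠ 0)
    (h : theta1 τ (2 * v) ≠ 0) : theta1 (τ / 2) v ≠ 0 := fun h' => by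
  have := theta1_half_mul_theta2_half_self hτ v
  rw [h', zero_mul] at this
  exact mul_ne_zero h h4 this.symm

lemma theta2_half_ne_zero {τ : ℂ} (hτ : 0 < τ.im) {v : ℂ} (h4 : theta4 τ 0 ≠ 0)
    (h : theta1 τ (2 * v) ≠ 0) : theta2 (τ / 2) v ≠ 0 := fun h' => by
  have := theta1_half_mul_theta2_half_self hτ v
  rw [h', mul_zero] at this
  exact mul_ne_zero h h4 this.symm

/-- Over a common denominator the sum of the `θ₄ / θ₁` has numerator `θ₁(x+y) θ₂(x-y)` with period
`τ / 2`, up to a constant. The factor `halfSc τ (x - y)` turns `θ₂(x-y)` into `θ₁(x-y)`, which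
produces the numerator of the difference of squares. -/
lemma halfSc_three_point {τ : ℂ} (hτ : 0 < τ.im) (h2 : theta2 τ 0 ≠ 0) (h3 : theta3 τ 0 ≠ 0)
    (h4 : theta4 τ 0 ≠ 0) {x y : ℂ} (hx : theta1 τ (2 * x) ≠ 0) (hy : theta1 τ (2 * y) ≠ 0)
    (hxy : theta1 τ (2 * (x - y)) ≠ 0) :
    halfSc τ (x - y) * (theta4 τ (2 * x) / theta1 τ (2 * x) + theta4 τ (2 * y) / theta1 τ (2 * y)) *
      (halfSc τ x * halfSc τ y) =
      theta4 τ 0 ^ 2 / (2 * theta2 τ 0 * theta3 τ 0) * (halfSc τ x ^ 2 - halfSc τ y ^ 2) := by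
  have a1 := theta1_half_ne_zero hτ h4 hx
  have a2 := theta2_half_ne_zero hτ h4 hx
  have b1 := theta1_half_ne_zero hτ h4 hy
  have b2 := theta2_half_ne_zero hτ h4 hy
  have d2 := theta2_half_ne_zero hτ h4 hxy
  have s1 := theta1_half_mul_theta2_half hτ (x + y) (x - y)
  have s2 := theta1_half_mul_theta1_half hτ (x + y) (x - y)
  rw [show x + y + (x - y) = 2 * x by ring, show x + y - (x - y) = 2 * y by ring] at s1 s2
  have x1 := theta1_half_mul_theta1_half hτ x x
  have x2 := theta2_half_mul_theta2_half hτ x x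
  have y1 := theta1_half_mul_theta1_half hτ y y
  have y2 := theta2_half_mul_theta2_half hτ y y
  rw [sub_self, ← two_mul] at x1 x2 y1 y2
  have hsum : theta4 τ (2 * x) / theta1 τ (2 * x) + theta4 τ (2 * y) / theta1 τ (2 * y) =
      theta1 (τ / 2) (x + y) * theta2 (τ / 2) (x - y) * theta4 τ 0 ^ 2 /
        (theta1 (τ / 2) x * theta2 (τ / 2) x * (theta1 (τ / 2) y * theta2 (τ / 2) y)) := by
    rw [theta1_half_mul_theta2_half_self hτ x, theta1_half_mul_theta2_half_self hτ y, s1]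
    field_simp
    ring
  have hl : halfSc τ (x - y) * (theta4 τ (2 * x) / theta1 τ (2 * x) +
      theta4 τ (2 * y) / theta1 τ (2 * y)) * (halfSc τ x * halfSc τ y) =
      theta4 τ 0 ^ 2 * (theta1 (τ / 2) (x + y) * theta1 (τ / 2) (x - y)) /
        (theta2 (τ / 2) x * theta2 (τ / 2) y) ^ 2 := by
    rw [hsum, halfSc, halfSc, halfSc]
    field_simp
  have hr : halfSc τ x ^ 2 - halfSc τ y ^ 2 =
      2 * theta2 τ 0 * theta3 τ 0 * (theta1 (τ / 2) (x + y) * theta1 (τ / 2) (x - y)) /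
        (theta2 (τ / 2) x * theta2 (τ / 2) y) ^ 2 := by
    rw [halfSc, halfSc, eq_div_iff (by positivity), s2]
    have e : ∀ {t1 t2 u1 u2 : ℂ}, t2 ≠ 0 → u2 ≠ 0 →
        ((t1 / t2) ^ 2 - (u1 / u2) ^ 2) * (t2 * u2) ^ 2 =
          t1 * t1 * (u2 * u2) - t2 * t2 * (u1 * u1) := by
      intro t1 t2 u1 u2 h h'
      field_simp
    rw [e a2 b2, x1, x2, y1, y2]
    ring
  rw [hl, hr]
  field_simp

/-- The sums and differences of the three pairs of arguments take only three values in all, so after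
clearing denominators both sides are polynomials in `θ₂`, `θ₃` at three points. -/
lemma halfSc_pfaffian {τ : ℂ} (hτ : 0 < τ.im) (a b c d : ℂ)
    (hab : theta2 (τ / 2) (a - b) ≠ 0) (hac : theta2 (τ / 2) (a - c) ≠ 0)
    (had : theta2 (τ / 2) (a - d) ≠ 0) (hbc : theta2 (τ / 2) (b - c) ≠ 0)
    (hbd : theta2 (τ / 2) (b - d) ≠ 0) (hcd : theta2 (τ / 2) (c - d) ≠ 0) :
    halfSc τ (a - b) * halfSc τ (c - d) - halfSc τ (a - c) * halfSc τ (b - d) +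
      halfSc τ (a - d) * halfSc τ (b - c) =
      halfSc τ (a - b) * halfSc τ (c - d) * (halfSc τ (a - c) * halfSc τ (b - d)) *
        (halfSc τ (a - d) * halfSc τ (b - c)) := by
  have p1 := theta1_half_mul_theta1_half hτ (a - b) (c - d)
  have q1 := theta2_half_mul_theta2_half hτ (a - b) (c - d)
  have p2 := theta1_half_mul_theta1_half hτ (a - c) (b - d)
  have q2 := theta2_half_mul_theta2_half hτ (a - c) (b - d)
  have p3 := theta1_half_mul_theta1_half hτ (a - d) (b - c)
  have q3 := theta2_half_mul_theta2_half hτ (a - d) (b - c)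
  rw [show a - b + (c - d) = a - d - (b - c) by ring,
    show a - b - (c - d) = a - c - (b - d) by ring] at p1 q1
  rw [show a - c + (b - d) = a - d + (b - c) by ring] at p2 q2
  have e : ∀ {s₁ s₂ s₃ s₄ s₅ s₆ t₁ t₂ t₃ t₄ t₅ t₆ : ℂ}, t₁ ≠ 0 → t₂ ≠ 0 → t₃ ≠ 0 → t₄ ≠ 0 →
      t₅ ≠ 0 → t₆ ≠ 0 →
      (s₁ * s₂) * (t₃ * t₄) * (t₅ * t₆) - (s₃ * s₄) * (t₁ * t₂) * (t₅ * t₆) +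
        (s₅ * s₆) * (t₁ * t₂) * (t₃ * t₄) = (s₁ * s₂) * (s₃ * s₄) * (s₅ * s₆) →
      s₁ / t₁ * (s₂ / t₂) - s₃ / t₃ * (s₄ / t₄) + s₅ / t₅ * (s₆ / t₆) =
        s₁ / t₁ * (s₂ / t₂) * (s₃ / t₃ * (s₄ / t₄)) * (s₅ / t₅ * (s₆ / t₆)) := by
    intro s₁ s₂ s₃ s₄ s₅ s₆ t₁ t₂ t₃ t₄ t₅ t₆ h1 h2 h3 h4 h5 h6 h
    field_simp
    linear_combination h
  simp only [halfSc]
  apply e hab hcd hac hbd had hbc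
  rw [p1, p2, p3, q1, q2, q3]
  ring

/-- The elliptic function of the theorem in terms of `halfSc`. -/
lemma sn_div_cn_mul_dn {τ : ℂ} (hτ : 0 < τ.im) (h2 : theta2 τ 0 ≠ 0) (h3 : theta3 τ 0 ≠ 0)
    (u : ℂ) (hu : IsRegularPoint τ u) :
    sn τ u / (cn τ u * dn τ u) =
      theta3 τ 0 ^ 2 / theta4 τ 0 ^ 2 * halfSc τ (thetaArg τ u) := by
  have h0 : theta2 (τ / 2) 0 ≠ 0 := fun h => by
    have := theta2_half_mul_const hτ 0
    rw [h, zero_mul] at this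
    exact mul_ne_zero two_ne_zero (mul_ne_zero h2 h3) this.symm
  have h4 := theta4_zero_ne_zero hτ h2 h3
  have hu' : theta4 τ (thetaArg τ u) ≠ 0 := hu
  have e : halfSc τ (thetaArg τ u) = theta1 τ (thetaArg τ u) * theta4 τ (thetaArg τ u) /
      (theta2 τ (thetaArg τ u) * theta3 τ (thetaArg τ u)) := by
    rw [halfSc, ← mul_div_mul_right _ _ h0, theta1_half_mul_const hτ, theta2_half_mul_const hτ,
      mul_div_mul_left _ _ two_ne_zero]
  rw [e, sn, cn, dn]
  field_simp

lemma thetaArg_half (τ u : ℂ) : 2 * thetaArg τ (u / 2) = thetaArg τ u := by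
  rw [thetaArg, thetaArg]; ring

lemma thetaArg_half_sub (τ a b : ℂ) :
    thetaArg τ ((a - b) / 2) = thetaArg τ (a / 2) - thetaArg τ (b / 2) := by
  rw [thetaArg, thetaArg, thetaArg]; ring

/-- Up to constants, `θ₁θ₄` and `θ₂θ₃` at `v` are `θ₁` and `θ₂` with period `τ / 2`, and the product
of the latter two is `θ₁(2v) θ₄(0)`. -/
lemma theta_half_ne_zero {τ : ℂ} (hτ : 0 < τ.im) (h2 : theta2 τ 0 ≠ 0) (h3 : theta3 τ 0 ≠ 0)
    {v : ℂ} (h : theta1 τ (2 * v) ≠ 0) : theta2 τ v ≠ 0 ∧ theta3 τ v ≠ 0 ∧ theta4 τ v ≠ 0 := by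
  have h4 := theta4_zero_ne_zero hτ h2 h3
  have h0 : theta2 (τ / 2) 0 ≠ 0 := fun h => by
    have := theta2_half_mul_const hτ 0
    rw [h, zero_mul] at this
    exact mul_ne_zero two_ne_zero (mul_ne_zero h2 h3) this.symm
  have e1 := mul_ne_zero (theta1_half_ne_zero hτ h4 h) h0
  have e2 := mul_ne_zero (theta2_half_ne_zero hτ h4 h) h0
  rw [theta1_half_mul_const hτ] at e1
  rw [theta2_half_mul_const hτ] at e2
  exact ⟨left_ne_zero_of_mul (right_ne_zero_of_mul e2),
    right_ne_zero_of_mul (right_ne_zero_of_mul e2),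
    right_ne_zero_of_mul (right_ne_zero_of_mul e1)⟩

/-- Division by zero gives zero, so a nonzero `sn` also certifies that the theta constants in its
denominators do not vanish. -/
lemma sn_ne_zero_iff (τ u : ℂ) : sn τ u ≠ 0 ↔ theta2 τ 0 ≠ 0 ∧ theta3 τ 0 ≠ 0 ∧
    theta1 τ (thetaArg τ u) ≠ 0 ∧ theta4 τ (thetaArg τ u) ≠ 0 := by
  simp only [sn, ne_eq, mul_eq_zero, div_eq_zero_iff]
  tauto

lemma sn_neg (τ u : ℂ) : sn τ (-u) = -sn τ u := by
  have : thetaArg τ (-u) = -thetaArg τ u := by rw [thetaArg, thetaArg, neg_div]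
  rw [sn, sn, this, theta1_neg, theta4_neg]; ring

/-- The quantities `F_{ij}` of the theorem. -/
def ellipticMatrix (τ : ℂ) (x : Fin 5 → ℂ) (i j : Fin 5) : ℂ :=
  sn τ ((x i - x j) / 2) / (cn τ ((x i - x j) / 2) * dn τ ((x i - x j) / 2))

lemma regular_half {τ : ℂ} (hτ : 0 < τ.im) {x : Fin 5 → ℂ}
    (hx : ∀ i j : Fin 5, i ≠ j → IsRegularPoint τ (x i - x j) ∧ sn τ (x i - x j) ≠ 0)
    (i j : Fin 5) : IsRegularPoint τ ((x i - x j) / 2) ∧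
      cn τ ((x i - x j) / 2) ≠ 0 ∧ dn τ ((x i - x j) / 2) ≠ 0 := by
  obtain ⟨h2, h3, -, -⟩ := (sn_ne_zero_iff _ _).1 (hx 0 1 (by decide)).2
  have h4 := theta4_zero_ne_zero hτ h2 h3
  have h : theta2 τ (thetaArg τ ((x i - x j) / 2)) ≠ 0 ∧
      theta3 τ (thetaArg τ ((x i - x j) / 2)) ≠ 0 ∧
      theta4 τ (thetaArg τ ((x i - x j) / 2)) ≠ 0 := by
    by_cases hij : i = j
    · subst hij
      rw [sub_self, zero_div, thetaArg, zero_div]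
      exact ⟨h2, h3, h4⟩
    · obtain ⟨-, -, h1, -⟩ := (sn_ne_zero_iff _ _).1 (hx i j hij).2
      rw [← thetaArg_half] at h1
      exact theta_half_ne_zero hτ h2 h3 h1
  refine ⟨h.2.2, ?_, ?_⟩
  · exact mul_ne_zero (div_ne_zero h4 h2) (div_ne_zero h.1 h.2.2)
  · exact mul_ne_zero (div_ne_zero h4 h3) (div_ne_zero h.2.1 h.2.2)

theorem exists_edgeData {τ : ℂ} (hτ : 0 < τ.im) {x : Fin 5 → ℂ}
    (hx : ∀ i j : Fin 5, i ≠ j → IsRegularPoint τ (x i - x j) ∧ sn τ (x i - x j) ≠ 0) :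
    ∃ K c, EdgeData (ellipticMatrix τ x) (fun i j => (sn τ (x i - x j))⁻¹) K c := by
  obtain ⟨h2, h3, -, -⟩ := (sn_ne_zero_iff _ _).1 (hx 0 1 (by decide)).2
  have h4 := theta4_zero_ne_zero hτ h2 h3
  set C := theta3 τ 0 ^ 2 / theta4 τ 0 ^ 2 with hC
  have hC0 : C ≠ 0 := by positivity
  let t : Fin 5 → ℂ := fun i => thetaArg τ (x i / 2)
  have hF : ∀ i j, ellipticMatrix τ x i j = C * halfSc τ (t i - t j) := fun i j => by
    rw [ellipticMatrix, sn_div_cn_mul_dn hτ h2 h3 _ (regular_half hτ hx i j).1, thetaArg_half_sub]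
  have hz : ∀ i j, thetaArg τ (x i - x j) = 2 * (t i - t j) := fun i j => by
    rw [← thetaArg_half, thetaArg_half_sub]
  have h1 : ∀ {i j}, i ≠ j → theta1 τ (2 * (t i - t j)) ≠ 0 := fun {i j} hij => by
    rw [← hz]; exact ((sn_ne_zero_iff _ _).1 (hx i j hij).2).2.2.1
  have hp : ∀ i j, (sn τ (x i - x j))⁻¹ = theta2 τ 0 / theta3 τ 0 *
      (theta4 τ (2 * (t i - t j)) / theta1 τ (2 * (t i - t j))) := fun i j => by
    rw [sn, hz, mul_inv, inv_div, inv_div]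
  have hT2 : ∀ {i j}, i ≠ j → theta2 (τ / 2) (t i - t j) ≠ 0 := fun hij =>
    theta2_half_ne_zero hτ h4 (h1 hij)
  -- The constants follow by homogeneity: `F` carries the factor `C`, and the three-point relation
  -- has `F³p` against `F²`, the Pfaffian one `F²` against `F⁶`.
  refine ⟨C * (theta2 τ 0 / theta3 τ 0) * (theta4 τ 0 ^ 2 / (2 * theta2 τ 0 * theta3 τ 0)),
    (C ^ 4)⁻¹, ?_, ?_, ?_, ?_, ?_, ?_, ?_⟩
  · intro i j
    rw [hF, hF, ← neg_sub, halfSc_neg]; ring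
  · intro i j
    rw [← neg_sub, sn_neg, inv_neg]
  · intro i j hij
    rw [hF]
    exact mul_ne_zero hC0 (div_ne_zero (theta1_half_ne_zero hτ h4 (h1 hij)) (hT2 hij))
  · intro i j hij
    exact inv_ne_zero (hx i j hij).2
  · exact inv_ne_zero (pow_ne_zero _ hC0)
  · intro i j k hij hik hjk
    have e : t j - t k = t j - t i - (t k - t i) := by ring
    have h := halfSc_three_point hτ h2 h3 h4 (h1 hij.symm) (h1 hik.symm) (e ▸ h1 hjk)
    rw [← e] at h
    simp only [hF, hp]
    linear_combination C ^ 3 * (theta2 τ 0 / theta3 τ 0) * h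
  · intro i j k l hij hik hil hjk hjl hkl
    have h := halfSc_pfaffian hτ (t i) (t j) (t k) (t l) (hT2 hij) (hT2 hik) (hT2 hil) (hT2 hjk)
      (hT2 hjl) (hT2 hkl)
    simp only [hF]
    have hCi : (C ^ 4)⁻¹ * C ^ 4 = 1 := inv_mul_cancel₀ (pow_ne_zero _ hC0)
    linear_combination C ^ 2 * h - C ^ 2 * (halfSc τ (t i - t j) * halfSc τ (t k - t l) *
      (halfSc τ (t i - t k) * halfSc τ (t j - t l)) *
      (halfSc τ (t i - t l) * halfSc τ (t j - t k))) * hCi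

/-! ### Edge operators of a Gaussian weight -/

lemma edge_cases (b : Edge) : b = edge 0 1 ∨ b = edge 0 2 ∨ b = edge 0 3 ∨ b = edge 0 4 ∨
    b = edge 1 2 ∨ b = edge 1 3 ∨ b = edge 1 4 ∨ b = edge 2 3 ∨ b = edge 2 4 ∨ b = edge 3 4 := by
  revert b; decide

lemma sum_edge {M : Type*} [AddCommMonoid M] (f : Edge → M) :
    ∑ b, f b = f (edge 0 1) + f (edge 0 2) + f (edge 0 3) + f (edge 0 4) + f (edge 1 2) +
      f (edge 1 3) + f (edge 1 4) + f (edge 2 3) + f (edge 2 4) + f (edge 3 4) := by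
  have : (Finset.univ : Finset Edge) = {edge 0 1, edge 0 2, edge 0 3, edge 0 4, edge 1 2,
      edge 1 3, edge 1 4, edge 2 3, edge 2 4, edge 3 4} := by decide
  rw [this]
  repeat rw [Finset.sum_insert (by decide)]
  rw [Finset.sum_singleton]
  simp only [add_assoc]

/-- The minor of a matrix with rows `i, j` and columns `k, l`. -/
def minor (F : Fin 5 → Fin 5 → ℂ) (i j k l : Fin 5) : ℂ := F i k * F j l - F i l * F j k

/-- The vector product of the rows `i` and `j` restricted to the other three columns: the
coefficients at the derivatives of an edge operator for the edge `ij`. -/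
def edgeVec (F : Fin 5 → Fin 5 → ℂ) : Fin 5 → Fin 5 → Fin 5 → ℂ
  | 0, 1 => ![0, 0, minor F 0 1 3 4, minor F 0 1 4 2, minor F 0 1 2 3]
  | 0, 2 => ![0, minor F 0 2 4 3, 0, minor F 0 2 1 4, minor F 0 2 3 1]
  | 0, 3 => ![0, minor F 0 3 2 4, minor F 0 3 4 1, 0, minor F 0 3 1 2]
  | 0, 4 => ![0, minor F 0 4 3 2, minor F 0 4 1 3, minor F 0 4 2 1, 0]
  | 1, 2 => ![minor F 1 2 3 4, 0, 0, minor F 1 2 4 0, minor F 1 2 0 3]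
  | 1, 3 => ![minor F 1 3 4 2, 0, minor F 1 3 0 4, 0, minor F 1 3 2 0]
  | 1, 4 => ![minor F 1 4 2 3, 0, minor F 1 4 3 0, minor F 1 4 0 2, 0]
  | 2, 3 => ![minor F 2 3 1 4, minor F 2 3 4 0, 0, 0, minor F 2 3 0 1]
  | 2, 4 => ![minor F 2 4 3 1, minor F 2 4 0 3, 0, minor F 2 4 1 0, 0]
  | 3, 4 => ![minor F 3 4 1 2, minor F 3 4 2 0, minor F 3 4 0 1, 0, 0]
  | _, _ => 0

/-- The operators annihilating the Gaussian weight of an antisymmetric matrix, as a function of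
the coefficients at the derivatives. -/
def graphMap (F : Fin 5 → Fin 5 → ℂ) : (Fin 5 → ℂ) →ₗ[ℂ] OpSpace :=
  LinearMap.id.prod (Matrix.vecMulLinear (Matrix.of F))

lemma graphMap_fst (F : Fin 5 → Fin 5 → ℂ) (β : Fin 5 → ℂ) : (graphMap F β).1 = β := rfl

lemma graphMap_snd (F : Fin 5 → Fin 5 → ℂ) (β : Fin 5 → ℂ) (m : Fin 5) :
    (graphMap F β).2 m = ∑ t, β t * F t m := rfl

lemma graphMap_injective (F : Fin 5 → Fin 5 → ℂ) : Function.Injective (graphMap F) :=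
  fun _ _ h => congrArg Prod.fst h

/-- The normalized edge operators. -/
def edgeOp (F p : Fin 5 → Fin 5 → ℂ) (b : Edge) : OpSpace :=
  graphMap F (p b.1.1 b.1.2 • edgeVec F b.1.1 b.1.2)

/-- The coefficients at the derivatives of the operator that corresponds to a 1-cochain. -/
def cochainVec (F p : Fin 5 → Fin 5 → ℂ) : (Edge → ℂ) →ₗ[ℂ] (Fin 5 → ℂ) :=
  Fintype.linearCombination ℂ fun b : Edge => p b.1.1 b.1.2 • edgeVec F b.1.1 b.1.2

lemma cochainVec_apply (F p : Fin 5 → Fin 5 → ℂ) (α : Edge → ℂ) (t : Fin 5) :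
    cochainVec F p α t = ∑ b : Edge, α b * (p b.1.1 b.1.2 * edgeVec F b.1.1 b.1.2 t) := by
  simp [cochainVec, Fintype.linearCombination_apply]

lemma cochainOperator_edgeOp (F p : Fin 5 → Fin 5 → ℂ) (α : Edge → ℂ) :
    cochainOperator (edgeOp F p) α = graphMap F (cochainVec F p α) := by
  simp [cochainOperator, edgeOp, cochainVec, Fintype.linearCombination_apply]

/-- A vector `w = (a, b, c)` orthogonal to `u` and `v` satisfies `w × (u × v) = u (w·v) - v (w·u) =
0`, hence is parallel to `u × v` when that is nonzero. -/
lemma exists_smul_cross {n₁ n₂ n₃ u₁ u₂ u₃ v₁ v₂ v₃ a b c : ℂ} (h₁ : n₁ = u₂ * v₃ - u₃ * v₂)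
    (h₂ : n₂ = u₃ * v₁ - u₁ * v₃) (h₃ : n₃ = u₁ * v₂ - u₂ * v₁)
    (hn : ¬(n₁ = 0 ∧ n₂ = 0 ∧ n₃ = 0)) (hu : a * u₁ + b * u₂ + c * u₃ = 0)
    (hv : a * v₁ + b * v₂ + c * v₃ = 0) : ∃ t, a = t * n₁ ∧ b = t * n₂ ∧ c = t * n₃ := by
  have e12 : a * n₂ = b * n₁ := by
    rw [h₁, h₂]; linear_combination u₃ * hv - v₃ * hu
  have e13 : a * n₃ = c * n₁ := by
    rw [h₁, h₃]; linear_combination v₂ * hu - u₂ * hv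
  have e23 : b * n₃ = c * n₂ := by
    rw [h₂, h₃]; linear_combination u₁ * hv - v₁ * hu
  by_cases h1 : n₁ = 0
  · by_cases h2 : n₂ = 0
    · have h3 : n₃ ≠ 0 := fun h3 => hn ⟨h1, h2, h3⟩
      refine ⟨c / n₃, ?_, ?_, ?_⟩
      · rw [eq_comm, div_mul_eq_mul_div, div_eq_iff h3, e13]
      · rw [eq_comm, div_mul_eq_mul_div, div_eq_iff h3, e23]
      · rw [div_mul_cancel₀ _ h3]
    · refine ⟨b / n₂, ?_, ?_, ?_⟩
      · rw [eq_comm, div_mul_eq_mul_div, div_eq_iff h2, e12]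
      · rw [div_mul_cancel₀ _ h2]
      · rw [eq_comm, div_mul_eq_mul_div, div_eq_iff h2, e23]
  · refine ⟨a / n₁, ?_, ?_, ?_⟩
    · rw [div_mul_cancel₀ _ h1]
    · rw [eq_comm, div_mul_eq_mul_div, div_eq_iff h1, e12]
    · rw [eq_comm, div_mul_eq_mul_div, div_eq_iff h1, e13]

/-! ### Algebraic consequences of the three-point and Pfaffian relations -/

namespace EdgeData

variable {F p : Fin 5 → Fin 5 → ℂ} {K c : ℂ}

/-- The linear relation between the edge operators at a vertex, for one coefficient. -/
lemma vertex_relation (h : EdgeData F p K c) {i j k l : Fin 5} (hij : i ≠ j) (hik : i ≠ k)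
    (hil : i ≠ l) (hjk : j ≠ k) (hjl : j ≠ l) (hkl : k ≠ l) :
    F i j * F k l * (p i k + p i l) - F i k * F j l * (p i j + p i l) +
      F i l * F j k * (p i j + p i k) = 0 := by
  have h1 := h.three_point hik hil hkl
  have h2 := h.three_point hij hil hjl
  have h3 := h.three_point hij hik hjk
  simp only [h.F_swap i, h.p_swap i] at h1 h2 h3
  refine (mul_eq_zero.1 ?_).resolve_left
    (mul_ne_zero (mul_ne_zero (h.F_ne hij) (h.F_ne hik)) (h.F_ne hil))
  -- With these weights the differences of squares multiplying `K` cancel.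
  linear_combination -F i j ^ 2 * h1 + F i k ^ 2 * h2 - F i l ^ 2 * h3

lemma pfaffian_ne (h : EdgeData F p K c) {i j k l : Fin 5} (hij : i ≠ j) (hik : i ≠ k)
    (hil : i ≠ l) (hjk : j ≠ k) (hjl : j ≠ l) (hkl : k ≠ l) :
    F i j * F k l - F i k * F j l + F i l * F j k ≠ 0 := by
  rw [h.pfaffian hij hik hil hjk hjl hkl]
  exact mul_ne_zero h.c_ne (mul_ne_zero (mul_ne_zero (mul_ne_zero (h.F_ne hij) (h.F_ne hkl))
    (mul_ne_zero (h.F_ne hik) (h.F_ne hjl))) (mul_ne_zero (h.F_ne hil) (h.F_ne hjk)))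

/-- The cocycle relation for `ω_{ijk} = s_{ij} s_{ik} s_{jk}`, where `s = 1 / p`. -/
lemma cocycle (h : EdgeData F p K c) {i j k l : Fin 5} (hij : i ≠ j) (hik : i ≠ k)
    (hil : i ≠ l) (hjk : j ≠ k) (hjl : j ≠ l) (hkl : k ≠ l) :
    (p j k)⁻¹ * (p j l)⁻¹ * (p k l)⁻¹ - (p i k)⁻¹ * (p i l)⁻¹ * (p k l)⁻¹ +
      (p i j)⁻¹ * (p i l)⁻¹ * (p j l)⁻¹ - (p i j)⁻¹ * (p i k)⁻¹ * (p j k)⁻¹ = 0 := by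
  have h1 := h.vertex_relation hij hik hil hjk hjl hkl
  have h2 := h.vertex_relation hij.symm hjk hjl hik hil hkl
  have h3 := h.vertex_relation hik.symm hjk.symm hkl hij hil hjl
  have hP := h.pfaffian_ne hij hik hil hjk hjl hkl
  rw [h.F_swap i j, h.p_swap i j] at h2
  rw [h.F_swap i k, h.p_swap i k, h.F_swap j k, h.p_swap j k] at h3
  -- The vertex relations are linear in the three products forming the Pfaffian. That vector of
  -- products is nonzero, so eliminating it leaves a cubic in `p`, which is the cocycle relation
  -- after division by all six `p`.
  have hdet : -(p i j * p j l * p j k) + p j k * p i k * p k l + p i l * p i j * p i k -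
      p i l * p j l * p k l = 0 := by
    refine (mul_eq_zero.1 ?_).resolve_right hP
    linear_combination
      ((-(p j l * p j k) + p i k * p j k - p i j * p j k + p j k * p k l + p i j * p i k -
          p j l * p k l) * h1 -
        (p i k * p j k - p i k * p i l - p i j * p j k - p i l * p k l + p i j * p i k +
          p i k * p k l) * h2 +
        (p i k * p j k - p i l * p j l - p i j * p j k - p i j * p i l + p i j * p j l +
          p i j * p i k) * h3) / 2
  have := h.p_ne hij
  have := h.p_ne hik
  have := h.p_ne hil
  have := h.p_ne hjk
  have := h.p_ne hjl
  have := h.p_ne hkl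
  field_simp
  linear_combination hdet

/-- Equal entries in row `j` force equal entries in row `i`. The three-point relation then gives `p
i l = -p i k`, and the vertex relation at `i` collapses to a nonzero multiple of `p i k`. -/
lemma false_of_minor_eq_zero (h : EdgeData F p K c) {i j k l : Fin 5} (hij : i ≠ j) (hik : i ≠ k)
    (hil : i ≠ l) (hjk : j ≠ k) (hjl : j ≠ l) (hkl : k ≠ l) (hm : minor F i j k l = 0)
    (he : F j k = F j l) : False := by
  rw [minor, he] at hm
  have hF : F i k = F i l := mul_right_cancel₀ (h.F_ne hjl) (sub_eq_zero.1 hm)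
  have h1 := h.three_point hik hil hkl
  rw [h.F_swap i k, h.F_swap i l, hF, sub_self, mul_zero] at h1
  have hp : p k i + p l i = 0 := by
    simpa [h.F_ne hkl, h.F_ne hil] using h1
  rw [h.p_swap i k, h.p_swap i l] at hp
  have h2 := h.vertex_relation hij hik hil hjk hjl hkl
  rw [he, hF] at h2
  refine mul_ne_zero (mul_ne_zero (h.F_ne hil) (h.F_ne hjl)) (h.p_ne hik) ?_
  linear_combination (h2 + (F i j * F k l - F i l * F j l) * hp) / 2

/-- When a minor vanishes, the left side of the Pfaffian relation reduces to one product, which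
cancels. Comparing two such relations gives `F i l * F j l = F i m * F j m`, to be combined with the
third minor. -/
lemma sq_eq_sq_of_minor_eq_zero (h : EdgeData F p K c) {i j k l m : Fin 5} (hij : i ≠ j)
    (hik : i ≠ k) (hil : i ≠ l) (him : i ≠ m) (hjk : j ≠ k) (hjl : j ≠ l) (hjm : j ≠ m)
    (hkl : k ≠ l) (hkm : k ≠ m) (h1 : minor F i j k l = 0) (h2 : minor F i j m k = 0)
    (h3 : minor F i j l m = 0) : F j l ^ 2 = F j m ^ 2 := by
  rw [minor] at h1 h2 h3
  have p1 := h.pfaffian hij hik hil hjk hjl hkl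
  have p2 := h.pfaffian hij hik him hjk hjm hkm
  have q1 : c * (F i k * F j l * (F i l * F j k)) = 1 := by
    refine mul_left_cancel₀ (mul_ne_zero (h.F_ne hij) (h.F_ne hkl)) ?_
    linear_combination -p1 - h1
  have q2 : c * (F i k * F j m * (F i m * F j k)) = 1 := by
    refine mul_left_cancel₀ (mul_ne_zero (h.F_ne hij) (h.F_ne hkm)) ?_
    linear_combination -p2 + h2
  have q3 : F i l * F j l = F i m * F j m := by
    refine mul_left_cancel₀ (mul_ne_zero h.c_ne (mul_ne_zero (h.F_ne hik) (h.F_ne hjk))) ?_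
    linear_combination q1 - q2
  refine mul_left_cancel₀ (h.F_ne hil) ?_
  linear_combination F j l * q3 - F j m * h3

/-- If all three minors vanished, the three entries of row `j` would have equal squares. Only two
signs are available, so two entries coincide. -/
lemma minor_ne (h : EdgeData F p K c) {i j k l m : Fin 5} (hij : i ≠ j)
    (hik : i ≠ k) (hil : i ≠ l) (him : i ≠ m) (hjk : j ≠ k) (hjl : j ≠ l) (hjm : j ≠ m)
    (hkl : k ≠ l) (hkm : k ≠ m) (hlm : l ≠ m) :
    ¬(minor F i j l m = 0 ∧ minor F i j m k = 0 ∧ minor F i j k l = 0) := by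
  rintro ⟨h3, h2, h1⟩
  have e1 := h.sq_eq_sq_of_minor_eq_zero hij hik hil him hjk hjl hjm hkl hkm h1 h2 h3
  have e2 := h.sq_eq_sq_of_minor_eq_zero hij hil him hik hjl hjm hjk hlm hkl.symm h3 h1 h2
  rcases sq_eq_sq_iff_eq_or_eq_neg.1 e1 with e1 | e1
  · exact h.false_of_minor_eq_zero hij hil him hjl hjm hlm h3 e1
  rcases sq_eq_sq_iff_eq_or_eq_neg.1 e2 with e2 | e2
  · exact h.false_of_minor_eq_zero hij him hik hjm hjk hkm.symm h2 e2
  · exact h.false_of_minor_eq_zero hij hik hil hjk hjl hkl h1 (by rw [e1, e2, neg_neg])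

end EdgeData

/-- The cone over a cocycle `ω_{ijk} = s_{ij} s_{ik} s_{jk}`, where `s = 1 / p`, with the apex `0`:
a 1-cochain with the coboundary `ω`. -/
def conePrimitive (p : Fin 5 → Fin 5 → ℂ) (b : Edge) : ℂ :=
  (p 0 b.1.1)⁻¹ * (p 0 b.1.2)⁻¹ * (p b.1.1 b.1.2)⁻¹

/-! ### Relations between the edge operators: coboundaries and the cone -/

namespace EdgeData

variable {F p : Fin 5 → Fin 5 → ℂ} {K c : ℂ}

lemma F_of_lt (h : EdgeData F p K c) {i j : Fin 5} (_ : i < j) : F j i = -F i j := h.F_swap i j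

lemma p_of_lt (h : EdgeData F p K c) {i j : Fin 5} (_ : i < j) : p j i = -p i j := h.p_swap i j

lemma p_self (h : EdgeData F p K c) (i : Fin 5) : p i i = 0 := self_eq_neg.1 (h.p_swap i i)

lemma vertex_relation_of_nodup (h : EdgeData F p K c) (i j k l : Fin 5)
    (hn : [i, j, k, l].Nodup := by decide) :
    F i j * F k l * (p i k + p i l) - F i k * F j l * (p i j + p i l) +
      F i l * F j k * (p i j + p i k) = 0 := by
  simp only [List.nodup_cons, List.mem_cons, List.not_mem_nil, or_false, not_or] at hn
  exact h.vertex_relation hn.1.1 hn.1.2.1 hn.1.2.2 hn.2.1.1 hn.2.1.2 hn.2.2.1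

/-- In the coefficient at `t`, the factor of `f i` is, up to sign, the vertex relation at `i` with
the three vertices other than `i` and `t`; for `i = t` it is zero. -/
lemma cochainVec_coboundary0 (h : EdgeData F p K c) (f : Fin 5 → ℂ) :
    cochainVec F p (coboundary0 f) = 0 := by
  funext t
  rw [cochainVec_apply, sum_edge]
  fin_cases t
  · have e1 := h.vertex_relation_of_nodup 1 2 3 4
    have e2 := h.vertex_relation_of_nodup 2 1 3 4
    have e3 := h.vertex_relation_of_nodup 3 1 2 4
    have e4 := h.vertex_relation_of_nodup 4 1 2 3
    simp [edge, edgeVec, coboundary0, minor, h.F_of_lt, h.p_of_lt] at e1 e2 e3 e4 ⊢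
    linear_combination f 1 * e1 - f 2 * e2 + f 3 * e3 - f 4 * e4
  · have e1 := h.vertex_relation_of_nodup 0 2 3 4
    have e2 := h.vertex_relation_of_nodup 2 0 3 4
    have e3 := h.vertex_relation_of_nodup 3 0 2 4
    have e4 := h.vertex_relation_of_nodup 4 0 2 3
    simp [edge, edgeVec, coboundary0, minor, h.F_of_lt, h.p_of_lt] at e1 e2 e3 e4 ⊢
    linear_combination -f 0 * e1 + f 2 * e2 - f 3 * e3 + f 4 * e4
  · have e1 := h.vertex_relation_of_nodup 0 1 3 4
    have e2 := h.vertex_relation_of_nodup 1 0 3 4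
    have e3 := h.vertex_relation_of_nodup 3 0 1 4
    have e4 := h.vertex_relation_of_nodup 4 0 1 3
    simp [edge, edgeVec, coboundary0, minor, h.F_of_lt, h.p_of_lt] at e1 e2 e3 e4 ⊢
    linear_combination f 0 * e1 - f 1 * e2 + f 3 * e3 - f 4 * e4
  · have e1 := h.vertex_relation_of_nodup 0 1 2 4
    have e2 := h.vertex_relation_of_nodup 1 0 2 4
    have e3 := h.vertex_relation_of_nodup 2 0 1 4
    have e4 := h.vertex_relation_of_nodup 4 0 1 2
    simp [edge, edgeVec, coboundary0, minor, h.F_of_lt, h.p_of_lt] at e1 e2 e3 e4 ⊢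
    linear_combination -f 0 * e1 + f 1 * e2 - f 2 * e3 + f 4 * e4
  · have e1 := h.vertex_relation_of_nodup 0 1 2 3
    have e2 := h.vertex_relation_of_nodup 1 0 2 3
    have e3 := h.vertex_relation_of_nodup 2 0 1 3
    have e4 := h.vertex_relation_of_nodup 3 0 1 2
    simp [edge, edgeVec, coboundary0, minor, h.F_of_lt, h.p_of_lt] at e1 e2 e3 e4 ⊢
    linear_combination f 0 * e1 - f 1 * e2 + f 2 * e3 - f 3 * e4

lemma p_mul_conePrimitive (h : EdgeData F p K c) {i j : Fin 5} (hij : i < j) :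
    conePrimitive p (edge i j hij) * p i j = (p 0 i)⁻¹ * (p 0 j)⁻¹ := by
  simp only [conePrimitive, edge]
  rw [inv_mul_cancel_right₀ (h.p_ne hij.ne)]

lemma coboundary1_conePrimitive (h : EdgeData F p K c) (s : Face) :
    coboundary1 (conePrimitive p) s =
      (p s.1.1 s.1.2.1)⁻¹ * (p s.1.1 s.1.2.2)⁻¹ * (p s.1.2.1 s.1.2.2)⁻¹ := by
  obtain ⟨⟨i, j, k⟩, hij, hjk⟩ := s
  simp only at hij hjk
  simp only [coboundary1, conePrimitive, edge]
  -- On faces at the apex `ν` vanishes on both edges through `0`, as `(p 0 0)⁻¹ = 0`; on the others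
  -- the cocycle relation applies.
  by_cases hi : i = 0
  · subst hi
    rw [h.p_self, inv_zero]; ring
  · have := h.cocycle (i := 0) (j := i) (k := j) (l := k) (Ne.symm hi)
      ((Fin.zero_le i).trans_lt hij).ne (((Fin.zero_le i).trans_lt hij).trans hjk).ne
      hij.ne (hij.trans hjk).ne hjk.ne
    linear_combination -this

/-- This is the cocycle relation on `0, 1, j, k` multiplied by `p j k`; it moves the apex from `0`
to `1`. -/
lemma conePrimitive_mul_eq (h : EdgeData F p K c) {j k : Fin 5} (hj : 1 < j) (hjk : j < k) :
    (p 0 j)⁻¹ * (p 0 k)⁻¹ = (p 1 j)⁻¹ * (p 1 k)⁻¹ +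
      p j k * ((p 0 1)⁻¹ * ((p 0 k)⁻¹ * (p 1 k)⁻¹ - (p 0 j)⁻¹ * (p 1 j)⁻¹)) := by
  have h1 : (0 : Fin 5) < 1 := by decide
  have hc := h.cocycle (i := 0) (j := 1) (k := j) (l := k) h1.ne (h1.trans hj).ne
    ((h1.trans hj).trans hjk).ne hj.ne (hj.trans hjk).ne hjk.ne
  have hs : p j k * (p j k)⁻¹ = 1 := mul_inv_cancel₀ (h.p_ne hjk.ne)
  linear_combination (-(p j k)) * hc +
    ((p 1 j)⁻¹ * (p 1 k)⁻¹ - (p 0 j)⁻¹ * (p 0 k)⁻¹) * hs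

/-- For `t ≠ 0` the edges at the apex drop out, and the rest is the vertex relation at `0` divided
by three factors `p`. For `t = 0` that relation is unavailable; moving the apex to `1` leaves a
combination of the vertex relations at `1, 2, 3, 4`. -/
lemma cochainVec_conePrimitive (h : EdgeData F p K c) :
    cochainVec F p (conePrimitive p) = 0 := by
  have hs : ∀ {i j}, i < j → p i j * (p i j)⁻¹ = 1 := fun hij => mul_inv_cancel₀ (h.p_ne hij.ne)
  have s01 := hs (show (0 : Fin 5) < 1 by decide)
  have s02 := hs (show (0 : Fin 5) < 2 by decide)
  have s03 := hs (show (0 : Fin 5) < 3 by decide)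
  have s04 := hs (show (0 : Fin 5) < 4 by decide)
  have s12 := hs (show (1 : Fin 5) < 2 by decide)
  have s13 := hs (show (1 : Fin 5) < 3 by decide)
  have s14 := hs (show (1 : Fin 5) < 4 by decide)
  funext t
  rw [cochainVec_apply, sum_edge]
  have hν : ∀ {i j : Fin 5} (hij : i < j), conePrimitive p (edge i j hij) *
      (p (edge i j hij).1.1 (edge i j hij).1.2 *
        edgeVec F (edge i j hij).1.1 (edge i j hij).1.2 t) =
      (p 0 i)⁻¹ * (p 0 j)⁻¹ * edgeVec F i j t := fun hij => by
    rw [← h.p_mul_conePrimitive hij, mul_assoc]; rfl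
  simp only [hν, h.p_self, inv_zero, zero_mul, zero_add]
  fin_cases t
  · have e1 := h.vertex_relation_of_nodup 1 2 3 4
    have e2 := h.vertex_relation_of_nodup 2 1 3 4
    have e3 := h.vertex_relation_of_nodup 3 1 2 4
    have e4 := h.vertex_relation_of_nodup 4 1 2 3
    have m23 := h.conePrimitive_mul_eq (j := 2) (k := 3) (by decide) (by decide)
    have m24 := h.conePrimitive_mul_eq (j := 2) (k := 4) (by decide) (by decide)
    have m34 := h.conePrimitive_mul_eq (j := 3) (k := 4) (by decide) (by decide)
    rw [m23, m24, m34]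
    simp [edgeVec, minor, h.F_of_lt, h.p_of_lt] at e1 e2 e3 e4 ⊢
    linear_combination -((p 1 2)⁻¹ * (p 1 3)⁻¹ * (p 1 4)⁻¹) * e1 +
      (F 1 4 * F 2 3 - F 1 3 * F 2 4) * ((p 1 3)⁻¹ * (p 1 4)⁻¹ + (p 0 1)⁻¹ * (p 0 2)⁻¹) * s12 +
      (F 1 2 * F 3 4 + F 1 4 * F 2 3) * ((p 1 2)⁻¹ * (p 1 4)⁻¹ + (p 0 1)⁻¹ * (p 0 3)⁻¹) * s13 +
      (F 1 2 * F 3 4 - F 1 3 * F 2 4) * ((p 1 2)⁻¹ * (p 1 3)⁻¹ + (p 0 1)⁻¹ * (p 0 4)⁻¹) * s14 +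
      (p 0 1)⁻¹ * (-((p 0 2)⁻¹ * (p 1 2)⁻¹) * e2 + (p 0 3)⁻¹ * (p 1 3)⁻¹ * e3 -
        (p 0 4)⁻¹ * (p 1 4)⁻¹ * e4)
  · have e1 := h.vertex_relation_of_nodup 0 2 3 4
    simp [edgeVec, minor, h.F_of_lt] at e1 ⊢
    linear_combination ((p 0 2)⁻¹ * (p 0 3)⁻¹ * (p 0 4)⁻¹) * e1 -
      (F 0 4 * F 2 3 - F 0 3 * F 2 4) * ((p 0 3)⁻¹ * (p 0 4)⁻¹) * s02 -
      (F 0 2 * F 3 4 + F 0 4 * F 2 3) * ((p 0 2)⁻¹ * (p 0 4)⁻¹) * s03 -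
      (F 0 2 * F 3 4 - F 0 3 * F 2 4) * ((p 0 2)⁻¹ * (p 0 3)⁻¹) * s04
  · have e1 := h.vertex_relation_of_nodup 0 1 3 4
    simp [edgeVec, minor, h.F_of_lt] at e1 ⊢
    linear_combination -((p 0 1)⁻¹ * (p 0 3)⁻¹ * (p 0 4)⁻¹) * e1 +
      (F 0 4 * F 1 3 - F 0 3 * F 1 4) * ((p 0 3)⁻¹ * (p 0 4)⁻¹) * s01 +
      (F 0 1 * F 3 4 + F 0 4 * F 1 3) * ((p 0 1)⁻¹ * (p 0 4)⁻¹) * s03 +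
      (F 0 1 * F 3 4 - F 0 3 * F 1 4) * ((p 0 1)⁻¹ * (p 0 3)⁻¹) * s04
  · have e1 := h.vertex_relation_of_nodup 0 1 2 4
    simp [edgeVec, minor, h.F_of_lt] at e1 ⊢
    linear_combination ((p 0 1)⁻¹ * (p 0 2)⁻¹ * (p 0 4)⁻¹) * e1 -
      (F 0 4 * F 1 2 - F 0 2 * F 1 4) * ((p 0 2)⁻¹ * (p 0 4)⁻¹) * s01 -
      (F 0 1 * F 2 4 + F 0 4 * F 1 2) * ((p 0 1)⁻¹ * (p 0 4)⁻¹) * s02 -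
      (F 0 1 * F 2 4 - F 0 2 * F 1 4) * ((p 0 1)⁻¹ * (p 0 2)⁻¹) * s04
  · have e1 := h.vertex_relation_of_nodup 0 1 2 3
    simp [edgeVec, minor, h.F_of_lt] at e1 ⊢
    linear_combination -((p 0 1)⁻¹ * (p 0 2)⁻¹ * (p 0 3)⁻¹) * e1 +
      (F 0 3 * F 1 2 - F 0 2 * F 1 3) * ((p 0 2)⁻¹ * (p 0 3)⁻¹) * s01 +
      (F 0 1 * F 2 3 + F 0 3 * F 1 2) * ((p 0 1)⁻¹ * (p 0 3)⁻¹) * s02 +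
      (F 0 1 * F 2 3 - F 0 2 * F 1 3) * ((p 0 1)⁻¹ * (p 0 2)⁻¹) * s03

end EdgeData

/-- The space of operators annihilating the Gaussian weight of the matrix `F`. -/
def gaussianSpace (F : Fin 5 → Fin 5 → ℂ) : Submodule ℂ OpSpace := LinearMap.range (graphMap F)

/-- Subtracting from an element of a larger isotropic space the graph element with the same
derivative part leaves only variables `x_t`. Pairing with the graph over the `t`-th basis vector
reads off the coefficient at `x_t`, so the remainder is zero. -/
lemma maximal_isotropic_gaussianSpace {F : Fin 5 → Fin 5 → ℂ} (hF : ∀ i j, F j i = -F i j) :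
    Maximal IsIsotropic (gaussianSpace F) := by
  refine ⟨?_, fun U hU hVU d hd => ?_⟩
  · rintro _ ⟨β, rfl⟩ _ ⟨β', rfl⟩
    simp only [scalarProduct, graphMap_fst, graphMap_snd, Finset.mul_sum, Finset.sum_add_distrib]
    rw [Finset.sum_comm, ← Finset.sum_add_distrib]
    refine Finset.sum_eq_zero fun i _ => ?_
    rw [← Finset.sum_add_distrib]
    refine Finset.sum_eq_zero fun j _ => ?_
    rw [hF i j]; ring
  · have hg : ∀ β, graphMap F β ∈ U := fun β => hVU ⟨β, rfl⟩
    have hd0 := U.sub_mem hd (hg d.1)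
    have hfst : (d - graphMap F d.1).1 = 0 := sub_self _
    have hsnd : (d - graphMap F d.1).2 = 0 := by
      funext t
      have := hU _ (hg (Pi.single t 1)) _ hd0
      simpa [scalarProduct, graphMap_fst, hfst, Pi.single_apply] using this
    exact ⟨d.1, (sub_eq_zero.1 (Prod.ext hfst hsnd)).symm⟩

lemma edgeVec_fst (F : Fin 5 → Fin 5 → ℂ) (b : Edge) : edgeVec F b.1.1 b.1.2 b.1.1 = 0 := by
  rcases edge_cases b with rfl | rfl | rfl | rfl | rfl | rfl | rfl | rfl | rfl | rfl <;> rfl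

lemma edgeVec_snd (F : Fin 5 → Fin 5 → ℂ) (b : Edge) : edgeVec F b.1.1 b.1.2 b.1.2 = 0 := by
  rcases edge_cases b with rfl | rfl | rfl | rfl | rfl | rfl | rfl | rfl | rfl | rfl <;> rfl

/-! ### Spaces of edge operators, their span and the dimension count -/

namespace EdgeData

variable {F p : Fin 5 → Fin 5 → ℂ} {K c : ℂ}

lemma sum_edgeVec_mul_fst (h : EdgeData F p K c) (b : Edge) :
    ∑ t, edgeVec F b.1.1 b.1.2 t * F t b.1.1 = 0 := by
  rcases edge_cases b with rfl | rfl | rfl | rfl | rfl | rfl | rfl | rfl | rfl | rfl <;>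
  · simp [edge, edgeVec, minor, Fin.sum_univ_five, h.F_of_lt]
    ring

lemma sum_edgeVec_mul_snd (h : EdgeData F p K c) (b : Edge) :
    ∑ t, edgeVec F b.1.1 b.1.2 t * F t b.1.2 = 0 := by
  rcases edge_cases b with rfl | rfl | rfl | rfl | rfl | rfl | rfl | rfl | rfl | rfl <;>
  · simp [edge, edgeVec, minor, Fin.sum_univ_five, h.F_of_lt]
    ring

lemma minor_ne_of_nodup (h : EdgeData F p K c) (i j k l m : Fin 5)
    (hn : [i, j, k, l, m].Nodup := by decide) :
    ¬(minor F i j l m = 0 ∧ minor F i j m k = 0 ∧ minor F i j k l = 0) := by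
  simp only [List.nodup_cons, List.mem_cons, List.not_mem_nil, or_false, not_or] at hn
  obtain ⟨⟨h1, h2, h3, h4⟩, ⟨h5, h6, h7⟩, ⟨h8, h9⟩, h10, -⟩ := hn
  exact h.minor_ne h1 h2 h3 h4 h5 h6 h7 h8 h9 h10

lemma edgeVec_ne_zero (h : EdgeData F p K c) (b : Edge) : edgeVec F b.1.1 b.1.2 ≠ 0 := by
  intro h0
  have h0 := fun t => congrFun h0 t
  rcases edge_cases b with rfl | rfl | rfl | rfl | rfl | rfl | rfl | rfl | rfl | rfl
  · exact h.minor_ne_of_nodup 0 1 2 3 4 (by decide) ⟨h0 2, h0 3, h0 4⟩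
  · exact h.minor_ne_of_nodup 0 2 1 4 3 (by decide) ⟨h0 1, h0 4, h0 3⟩
  · exact h.minor_ne_of_nodup 0 3 1 2 4 (by decide) ⟨h0 1, h0 2, h0 4⟩
  · exact h.minor_ne_of_nodup 0 4 1 3 2 (by decide) ⟨h0 1, h0 3, h0 2⟩
  · exact h.minor_ne_of_nodup 1 2 0 3 4 (by decide) ⟨h0 0, h0 3, h0 4⟩
  · exact h.minor_ne_of_nodup 1 3 0 4 2 (by decide) ⟨h0 0, h0 4, h0 2⟩
  · exact h.minor_ne_of_nodup 1 4 0 2 3 (by decide) ⟨h0 0, h0 2, h0 3⟩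
  · exact h.minor_ne_of_nodup 2 3 0 1 4 (by decide) ⟨h0 0, h0 1, h0 4⟩
  · exact h.minor_ne_of_nodup 2 4 0 3 1 (by decide) ⟨h0 0, h0 3, h0 1⟩
  · exact h.minor_ne_of_nodup 3 4 0 1 2 (by decide) ⟨h0 0, h0 1, h0 2⟩

lemma exists_mul_minor (h : EdgeData F p K c) (i j k l m : Fin 5)
    (hn : [i, j, k, l, m].Nodup) (hu : (Finset.univ : Finset (Fin 5)) = {i, j, k, l, m})
    {β : Fin 5 → ℂ} (hi : β i = 0) (hj : β j = 0)
    (ei : ∑ t, β t * F t i = 0) (ej : ∑ t, β t * F t j = 0) :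
    ∃ t, β k = t * minor F i j l m ∧ β l = t * minor F i j m k ∧ β m = t * minor F i j k l := by
  have hne := h.minor_ne_of_nodup i j k l m hn
  simp only [List.nodup_cons, List.mem_cons, List.not_mem_nil, or_false, not_or] at hn
  obtain ⟨⟨h1, h2, h3, h4⟩, ⟨h5, h6, h7⟩, ⟨h8, h9⟩, h10, -⟩ := hn
  have hs : ∀ f : Fin 5 → ℂ, ∑ t, f t = f i + (f j + (f k + (f l + f m))) := fun f => by
    rw [hu, Finset.sum_insert (by simp [*]), Finset.sum_insert (by simp [*]),
      Finset.sum_insert (by simp [*]), Finset.sum_insert (by simp [*]), Finset.sum_singleton]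
  rw [hs, hi, hj, h.F_swap i k, h.F_swap i l, h.F_swap i m] at ei
  rw [hs, hi, hj, h.F_swap j k, h.F_swap j l, h.F_swap j m] at ej
  refine exists_smul_cross (u₁ := F i k) (u₂ := F i l) (u₃ := F i m) (v₁ := F j k) (v₂ := F j l)
    (v₃ := F j m) rfl rfl rfl hne ?_ ?_
  · linear_combination -ei
  · linear_combination -ej

lemma exists_smul_edgeVec (h : EdgeData F p K c) (b : Edge) {β : Fin 5 → ℂ} (hi : β b.1.1 = 0)
    (hj : β b.1.2 = 0) (ei : ∑ t, β t * F t b.1.1 = 0) (ej : ∑ t, β t * F t b.1.2 = 0) :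
    ∃ t : ℂ, β = t • edgeVec F b.1.1 b.1.2 := by
  rcases edge_cases b with rfl | rfl | rfl | rfl | rfl | rfl | rfl | rfl | rfl | rfl
  · obtain ⟨t, h1, h2, h3⟩ := h.exists_mul_minor 0 1 2 3 4 (by decide) (by decide) hi hj ei ej
    exact ⟨t, by funext s; fin_cases s <;> simp_all [edge, edgeVec]⟩
  · obtain ⟨t, h1, h2, h3⟩ := h.exists_mul_minor 0 2 1 4 3 (by decide) (by decide) hi hj ei ej
    exact ⟨t, by funext s; fin_cases s <;> simp_all [edge, edgeVec]⟩
  · obtain ⟨t, h1, h2, h3⟩ := h.exists_mul_minor 0 3 1 2 4 (by decide) (by decide) hi hj ei ej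
    exact ⟨t, by funext s; fin_cases s <;> simp_all [edge, edgeVec]⟩
  · obtain ⟨t, h1, h2, h3⟩ := h.exists_mul_minor 0 4 1 3 2 (by decide) (by decide) hi hj ei ej
    exact ⟨t, by funext s; fin_cases s <;> simp_all [edge, edgeVec]⟩
  · obtain ⟨t, h1, h2, h3⟩ := h.exists_mul_minor 1 2 0 3 4 (by decide) (by decide) hi hj ei ej
    exact ⟨t, by funext s; fin_cases s <;> simp_all [edge, edgeVec]⟩
  · obtain ⟨t, h1, h2, h3⟩ := h.exists_mul_minor 1 3 0 4 2 (by decide) (by decide) hi hj ei ej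
    exact ⟨t, by funext s; fin_cases s <;> simp_all [edge, edgeVec]⟩
  · obtain ⟨t, h1, h2, h3⟩ := h.exists_mul_minor 1 4 0 2 3 (by decide) (by decide) hi hj ei ej
    exact ⟨t, by funext s; fin_cases s <;> simp_all [edge, edgeVec]⟩
  · obtain ⟨t, h1, h2, h3⟩ := h.exists_mul_minor 2 3 0 1 4 (by decide) (by decide) hi hj ei ej
    exact ⟨t, by funext s; fin_cases s <;> simp_all [edge, edgeVec]⟩
  · obtain ⟨t, h1, h2, h3⟩ := h.exists_mul_minor 2 4 0 3 1 (by decide) (by decide) hi hj ei ej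
    exact ⟨t, by funext s; fin_cases s <;> simp_all [edge, edgeVec]⟩
  · obtain ⟨t, h1, h2, h3⟩ := h.exists_mul_minor 3 4 0 1 2 (by decide) (by decide) hi hj ei ej
    exact ⟨t, by funext s; fin_cases s <;> simp_all [edge, edgeVec]⟩

lemma edgeOperators_eq_span (h : EdgeData F p K c) (b : Edge) :
    edgeOperators (gaussianSpace F) b = Submodule.span ℂ {edgeOp F p b} := by
  ext d
  rw [Submodule.mem_span_singleton]
  have hp : p b.1.1 b.1.2 ≠ 0 := h.p_ne b.2.ne
  constructor
  · rintro ⟨⟨β, rfl⟩, h0⟩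
    obtain ⟨hi, ei⟩ := h0 b.1.1 (Or.inl rfl)
    obtain ⟨hj, ej⟩ := h0 b.1.2 (Or.inr rfl)
    obtain ⟨t, ht⟩ := h.exists_smul_edgeVec b hi hj ei ej
    refine ⟨t / p b.1.1 b.1.2, ?_⟩
    rw [edgeOp, ← map_smul, smul_smul, div_mul_cancel₀ _ hp, ← ht]
    rfl
  · rintro ⟨t, rfl⟩
    refine Submodule.smul_mem _ _ ⟨⟨_, rfl⟩, ?_⟩
    rw [edgeOp, map_smul]
    rintro s (rfl | rfl)
    · have e1 := edgeVec_fst F b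
      have e2 := h.sum_edgeVec_mul_fst b
      simp [graphMap_fst, graphMap_snd, e1, e2]
    · have e1 := edgeVec_snd F b
      have e2 := h.sum_edgeVec_mul_snd b
      simp [graphMap_fst, graphMap_snd, e1, e2]

lemma isNormalizedFamily (h : EdgeData F p K c) :
    IsNormalizedFamily (gaussianSpace F) (edgeOp F p) where
  span_eq := h.edgeOperators_eq_span
  ne_zero b hb := smul_ne_zero (h.p_ne b.2.ne) (h.edgeVec_ne_zero b)
    (graphMap_injective F (hb.trans (map_zero _).symm))
  coboundary f := by rw [cochainOperator_edgeOp, h.cochainVec_coboundary0, map_zero]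

lemma pfaffian_ne_of_nodup (h : EdgeData F p K c) (i j k l : Fin 5)
    (hn : [i, j, k, l].Nodup := by decide) :
    F i j * F k l - F i k * F j l + F i l * F j k ≠ 0 := by
  simp only [List.nodup_cons, List.mem_cons, List.not_mem_nil, or_false, not_or] at hn
  exact h.pfaffian_ne hn.1.1 hn.1.2.1 hn.1.2.2 hn.2.1.1 hn.2.1.2 hn.2.2.1

/-- The edge operators span: each coordinate vector is obtained, up to a Pfaffian, from the
cochain with values `±1 / p`. -/
lemma exists_cochainVec_eq_single (h : EdgeData F p K c) (m : Fin 5) :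
    ∃ (α : Edge → ℂ) (a : ℂ), a ≠ 0 ∧ cochainVec F p α = Pi.single m a := by
  -- The factor `1 / p` undoes the normalization. With sign `-1` on the edges through `m`, all
  -- components but the `m`-th cancel; in that one each product of the complementary Pfaffian occurs
  -- in four minors.
  let α : Edge → ℂ := fun b => (if m = b.1.1 ∨ m = b.1.2 then -1 else 1) * (p b.1.1 b.1.2)⁻¹
  have hα : ∀ t, cochainVec F p α t =
      ∑ b : Edge, (if m = b.1.1 ∨ m = b.1.2 then -1 else 1) * edgeVec F b.1.1 b.1.2 t :=
    fun t => by
      rw [cochainVec_apply]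
      refine Finset.sum_congr rfl fun b _ => ?_
      rw [mul_assoc, inv_mul_cancel_left₀ (h.p_ne b.2.ne)]
  have h4 : (4 : ℂ) ≠ 0 := by norm_num
  fin_cases m
  · refine ⟨α, -4 * _, mul_ne_zero (neg_ne_zero.2 h4) (h.pfaffian_ne_of_nodup 1 2 3 4), ?_⟩
    funext t
    rw [hα, sum_edge]
    fin_cases t <;> simp [edge, edgeVec, minor, h.F_of_lt] <;> ring
  · refine ⟨α, 4 * _, mul_ne_zero h4 (h.pfaffian_ne_of_nodup 0 2 3 4), ?_⟩
    funext t
    rw [hα, sum_edge]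
    fin_cases t <;> simp [edge, edgeVec, minor, h.F_of_lt] <;> ring
  · refine ⟨α, -4 * _, mul_ne_zero (neg_ne_zero.2 h4) (h.pfaffian_ne_of_nodup 0 1 3 4), ?_⟩
    funext t
    rw [hα, sum_edge]
    fin_cases t <;> simp [edge, edgeVec, minor, h.F_of_lt] <;> ring
  · refine ⟨α, 4 * _, mul_ne_zero h4 (h.pfaffian_ne_of_nodup 0 1 2 4), ?_⟩
    funext t
    rw [hα, sum_edge]
    fin_cases t <;> simp [edge, edgeVec, minor, h.F_of_lt] <;> ring
  · refine ⟨α, -4 * _, mul_ne_zero (neg_ne_zero.2 h4) (h.pfaffian_ne_of_nodup 0 1 2 3), ?_⟩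
    funext t
    rw [hα, sum_edge]
    fin_cases t <;> simp [edge, edgeVec, minor, h.F_of_lt] <;> ring

lemma ker_cochainVec_finrank (h : EdgeData F p K c) :
    Module.finrank ℂ (LinearMap.ker (cochainVec F p)) = 5 := by
  have hr : LinearMap.range (cochainVec F p) = ⊤ := by
    rw [eq_top_iff]
    rintro β -
    rw [pi_eq_sum_univ' β]
    refine Submodule.sum_mem _ fun m _ => Submodule.smul_mem _ _ ?_
    obtain ⟨α, a, ha, hα⟩ := h.exists_cochainVec_eq_single m
    refine ⟨a⁻¹ • α, ?_⟩
    rw [map_smul, hα]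
    funext t
    by_cases ht : t = m
    · subst ht; simp [ha]
    · simp [ht]
  have := LinearMap.finrank_range_add_finrank_ker (cochainVec F p)
  have hc : Fintype.card Edge = 10 := by decide
  rw [hr, finrank_top, Module.finrank_pi, Module.finrank_pi, hc, Fintype.card_fin] at this
  omega

/-- The 1-cochains that are sums of a coboundary and a multiple of `ν`, parametrized by
`f 1, …, f 4` and the multiplier `f 0`. -/
def _root_.EllipticWeight.addMulCochain (ν : Edge → ℂ) : (Fin 5 → ℂ) →ₗ[ℂ] (Edge → ℂ) where
  toFun f := coboundary0 (Function.update f 0 0) + f 0 • ν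
  map_add' f g := by
    funext b
    simp only [coboundary0, Pi.add_apply, Pi.smul_apply, smul_eq_mul, Function.update_apply]
    split_ifs <;> ring
  map_smul' a f := by
    funext b
    simp only [coboundary0, Pi.add_apply, Pi.smul_apply, smul_eq_mul, Function.update_apply,
      RingHom.id_apply]
    split_ifs <;> ring

/-- Applying `δ` kills the coboundary and leaves `f 0 • δν`, so `f 0 = 0`; the edges `0j` then
return the other values. -/
lemma _root_.EllipticWeight.addMulCochain_injective {ν : Edge → ℂ} (hν : coboundary1 ν ≠ 0) :
    Function.Injective (addMulCochain ν) := by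
  rw [injective_iff_map_eq_zero]
  intro f hf
  have hb : ∀ b : Edge, Function.update f 0 0 b.1.2 - Function.update f 0 0 b.1.1 +
      f 0 * ν b = 0 := fun b => congrFun hf b
  have h0 : f 0 = 0 := by
    by_contra h0
    refine hν (funext fun s => mul_left_cancel₀ h0 ?_)
    have e1 := hb (edge s.1.2.1 s.1.2.2 s.2.2)
    have e2 := hb (edge s.1.1 s.1.2.2 (s.2.1.trans s.2.2))
    have e3 := hb (edge s.1.1 s.1.2.1 s.2.1)
    simp only [coboundary1, Pi.zero_apply]
    simp only [edge] at e1 e2 e3 ⊢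
    linear_combination e1 - e2 + e3
  funext j
  by_cases hj : j = 0
  · rw [hj, h0, Pi.zero_apply]
  · have := hb (edge 0 j (Fin.pos_iff_ne_zero.2 hj))
    simpa [edge, hj, h0] using this

theorem isCocycleOfWeight (h : EdgeData F p K c) {W : Grassmann}
    (hW : IsQuasiGaussianWeight (gaussianSpace F) W) :
    IsCocycleOfWeight W fun s =>
      (p s.1.1 s.1.2.1)⁻¹ * (p s.1.1 s.1.2.2)⁻¹ * (p s.1.2.1 s.1.2.2)⁻¹ := by
  have hν : coboundary1 (conePrimitive p) = fun s : Face =>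
      (p s.1.1 s.1.2.1)⁻¹ * (p s.1.1 s.1.2.2)⁻¹ * (p s.1.2.1 s.1.2.2)⁻¹ :=
    funext h.coboundary1_conePrimitive
  have h0 : (fun s : Face =>
      (p s.1.1 s.1.2.1)⁻¹ * (p s.1.1 s.1.2.2)⁻¹ * (p s.1.2.1 s.1.2.2)⁻¹) ≠ 0 := fun h0 => by
    have h01 : p 0 1 ≠ 0 := h.p_ne (by decide)
    have h02 : p 0 2 ≠ 0 := h.p_ne (by decide)
    have h12 : p 1 2 ≠ 0 := h.p_ne (by decide)
    exact mul_ne_zero (mul_ne_zero (inv_ne_zero h01) (inv_ne_zero h02)) (inv_ne_zero h12)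
      (congrFun h0 (face 0 1 2))
  refine ⟨h0, gaussianSpace F, edgeOp F p, conePrimitive p, hW, h.isNormalizedFamily, hν,
    fun α => ?_⟩
  have hker : cochainOperator (edgeOp F p) α = 0 ↔ α ∈ LinearMap.ker (cochainVec F p) := by
    rw [cochainOperator_edgeOp, LinearMap.mem_ker, map_eq_zero_iff _ (graphMap_injective F)]
  have hmem : ∀ f a, coboundary0 f + a • conePrimitive p ∈ LinearMap.ker (cochainVec F p) :=
    fun f a => by
      rw [LinearMap.mem_ker, map_add, map_smul, h.cochainVec_coboundary0,
        h.cochainVec_conePrimitive, smul_zero, add_zero]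
  have hrange : LinearMap.range (addMulCochain (conePrimitive p)) =
      LinearMap.ker (cochainVec F p) := by
    refine Submodule.eq_of_le_of_finrank_eq ?_ ?_
    · rintro _ ⟨f, rfl⟩
      exact hmem _ _
    · rw [h.ker_cochainVec_finrank,
        LinearMap.finrank_range_of_inj (addMulCochain_injective (hν ▸ h0)), Module.finrank_pi,
        Fintype.card_fin]
  rw [hker]
  constructor
  · intro hα
    rw [← hrange] at hα
    obtain ⟨f, hf⟩ := hα
    exact ⟨_, _, hf.symm⟩
  · rintro ⟨f, a, rfl⟩
    exact hmem f a

end EdgeData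

/-! ### Grassmann–Gaussian exponents -/

lemma gvar_mul_gvar_swap (a b : Fin 5) : gvar a * gvar b = -(gvar b * gvar a) :=
  eq_neg_of_add_eq_zero_left (ExteriorAlgebra.ι_add_mul_swap _ _)

lemma gvar_mul_self (a : Fin 5) : gvar a * gvar a = 0 := ExteriorAlgebra.ι_sq_zero _

lemma commute_gvar (a b c : Fin 5) : Commute (gvar c) (gvar a * gvar b) := by
  rw [commute_iff_eq, ← mul_assoc, gvar_mul_gvar_swap c a, neg_mul, mul_assoc,
    gvar_mul_gvar_swap c b, mul_neg, neg_neg, mul_assoc]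

lemma leftDeriv_gvar_mul (t a : Fin 5) (W : Grassmann) :
    leftDeriv t (gvar a * W) = (if a = t then W else 0) - gvar a * leftDeriv t W := by
  have h := CliffordAlgebra.contractLeft_ι_mul (Q := (0 : QuadraticForm ℂ (Fin 5 → ℂ)))
    (d := LinearMap.proj t) (Pi.single a 1) W
  refine h.trans ?_
  by_cases hat : a = t
  · subst hat; simp; rfl
  · simp [hat, Ne.symm hat]; rfl

lemma leftDeriv_one (t : Fin 5) : leftDeriv t 1 = 0 := CliffordAlgebra.contractLeft_one _ _

/-- The quadratic form of a skew-symmetric matrix. -/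
def matrixForm (F : Fin 5 → Fin 5 → ℂ) : Grassmann :=
  ∑ e : Edge, F e.1.1 e.1.2 • (gvar e.1.2 * gvar e.1.1)

lemma matrixForm_eq (F : Fin 5 → Fin 5 → ℂ) : matrixForm F =
    F 0 1 • (gvar 1 * gvar 0) + F 0 2 • (gvar 2 * gvar 0) + F 0 3 • (gvar 3 * gvar 0) +
      F 0 4 • (gvar 4 * gvar 0) + F 1 2 • (gvar 2 * gvar 1) + F 1 3 • (gvar 3 * gvar 1) +
      F 1 4 • (gvar 4 * gvar 1) + F 2 3 • (gvar 3 * gvar 2) + F 2 4 • (gvar 4 * gvar 2) +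
      F 3 4 • (gvar 4 * gvar 3) :=
  sum_edge _

lemma isNilpotent_matrixForm (F : Fin 5 → Fin 5 → ℂ) : IsNilpotent (matrixForm F) := by
  refine Commute.isNilpotent_sum (fun e _ => ⟨2, ?_⟩) fun e e' _ _ => ?_
  · rw [pow_two, smul_mul_smul_comm, mul_assoc, ← mul_assoc (gvar e.1.1),
      gvar_mul_gvar_swap e.1.1, neg_mul, mul_assoc, gvar_mul_self, mul_zero, neg_zero, mul_zero,
      smul_zero]
  · exact (((commute_gvar _ _ _).mul_left (commute_gvar _ _ _)).smul_left _).smul_right _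

/-- The left derivative of `matrixForm F`. -/
def matrixFormDeriv (F : Fin 5 → Fin 5 → ℂ) (t : Fin 5) : Grassmann := -∑ m, F t m • gvar m

/-- The form is even, so the antiderivation obeys the Leibniz rule without a sign. -/
lemma leftDeriv_matrixForm_mul {F : Fin 5 → Fin 5 → ℂ} (hF : ∀ i j, F j i = -F i j) (t : Fin 5)
    (W : Grassmann) : leftDeriv t (matrixForm F * W) =
      matrixFormDeriv F t * W + matrixForm F * leftDeriv t W := by
  have hself : ∀ i, F i i = 0 := fun i => self_eq_neg.1 (hF i i)
  have hlt : ∀ {i j : Fin 5}, i < j → F j i = -F i j := fun {i j} _ => hF i j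
  have hD : matrixFormDeriv F t = ∑ e : Edge, F e.1.1 e.1.2 •
      ((if e.1.2 = t then gvar e.1.1 else 0) - (if e.1.1 = t then gvar e.1.2 else 0)) := by
    rw [matrixFormDeriv, sum_edge, Fin.sum_univ_five]
    fin_cases t <;> simp [edge, hself, hlt] <;> abel
  have hterm : ∀ a b, leftDeriv t (gvar b * gvar a * W) =
      ((if b = t then gvar a else 0) - (if a = t then gvar b else 0)) * W +
        gvar b * gvar a * leftDeriv t W := fun a b => by
    rw [mul_assoc, leftDeriv_gvar_mul, leftDeriv_gvar_mul]
    split_ifs <;> noncomm_ring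
  simp only [hD, matrixForm, Finset.sum_mul, map_sum, smul_mul_assoc, map_smul, hterm, smul_add,
    Finset.sum_add_distrib]

lemma commute_matrixFormDeriv (F : Fin 5 → Fin 5 → ℂ) (t : Fin 5) :
    Commute (matrixFormDeriv F t) (matrixForm F) :=
  (Commute.sum_left _ _ _ fun _ _ => Commute.sum_right _ _ _ fun _ _ =>
    ((commute_gvar _ _ _).smul_left _).smul_right _).neg_left

lemma leftDeriv_matrixForm_pow {F : Fin 5 → Fin 5 → ℂ} (hF : ∀ i j, F j i = -F i j) (t : Fin 5)
    (n : ℕ) : leftDeriv t (matrixForm F ^ (n + 1)) =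
      ((n + 1 : ℕ) : ℚ) • (matrixFormDeriv F t * matrixForm F ^ n) := by
  induction n with
  | zero => simpa [leftDeriv_one] using leftDeriv_matrixForm_mul hF t 1
  | succ n ih =>
    rw [pow_succ', leftDeriv_matrixForm_mul hF, ih, mul_smul_comm, ← mul_assoc,
      ← (commute_matrixFormDeriv F t).eq, mul_assoc, ← pow_succ', Nat.cast_succ (n + 1), add_smul,
      one_smul, add_comm]

lemma leftDeriv_exp_matrixForm {F : Fin 5 → Fin 5 → ℂ} (hF : ∀ i j, F j i = -F i j) (t : Fin 5) :
    leftDeriv t (IsNilpotent.exp (matrixForm F)) =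
      matrixFormDeriv F t * IsNilpotent.exp (matrixForm F) := by
  obtain ⟨n, hn⟩ := isNilpotent_matrixForm F
  have hn' : matrixForm F ^ (n + 1) = 0 := by rw [pow_succ, hn, zero_mul]
  -- The left series is truncated one term later than the right one, since differentiation kills the
  -- constant term and shifts the index.
  conv_lhs => rw [IsNilpotent.exp_eq_sum hn', map_sum, Finset.sum_range_succ']
  rw [IsNilpotent.exp_eq_sum hn, Finset.mul_sum, pow_zero, map_rat_smul, leftDeriv_one, smul_zero,
    add_zero]
  refine Finset.sum_congr rfl fun k _ => ?_
  rw [map_rat_smul, leftDeriv_matrixForm_pow hF, smul_smul, mul_smul_comm]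
  congr 1
  rw [Nat.factorial_succ, Nat.cast_mul, mul_inv, mul_right_comm, inv_mul_cancel₀, one_mul]
  exact_mod_cast Nat.succ_ne_zero k

lemma act_graphMap_exp {F : Fin 5 → Fin 5 → ℂ} (hF : ∀ i j, F j i = -F i j) (β : Fin 5 → ℂ) :
    act (graphMap F β) (IsNilpotent.exp (matrixForm F)) = 0 := by
  simp only [act, LinearMap.sum_apply, LinearMap.add_apply, LinearMap.smul_apply,
    LinearMap.mulLeft_apply, leftDeriv_exp_matrixForm hF, graphMap_fst, graphMap_snd,
    ← smul_mul_assoc, ← add_mul, ← Finset.sum_mul]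
  convert zero_mul _
  simp only [matrixFormDeriv, smul_neg, Finset.smul_sum, Finset.sum_add_distrib, Finset.sum_smul,
    Finset.sum_neg_distrib, smul_smul]
  rw [Finset.sum_comm, neg_add_cancel]

theorem isQuasiGaussianWeight_exp {F : Fin 5 → Fin 5 → ℂ} (hF : ∀ i j, F j i = -F i j) :
    IsQuasiGaussianWeight (gaussianSpace F) (IsNilpotent.exp (matrixForm F)) where
  maximal_isotropic := maximal_isotropic_gaussianSpace hF
  ne_zero := (IsNilpotent.isUnit_exp (isNilpotent_matrixForm F)).ne_zero
  annihilated := by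
    rintro _ ⟨β, rfl⟩
    exact act_graphMap_exp hF β

/-! ### Passing from face coefficients to the matrix -/

lemma sum_face {M : Type*} [AddCommMonoid M] (f : Face → M) :
    ∑ s, f s = f (face 0 1 2) + f (face 0 1 3) + f (face 0 1 4) + f (face 0 2 3) +
      f (face 0 2 4) + f (face 0 3 4) + f (face 1 2 3) + f (face 1 2 4) + f (face 1 3 4) +
      f (face 2 3 4) := by
  have : (Finset.univ : Finset Face) = {face 0 1 2, face 0 1 3, face 0 1 4, face 0 2 3,
      face 0 2 4, face 0 3 4, face 1 2 3, face 1 2 4, face 1 3 4, face 2 3 4} := by decide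
  rw [this]
  repeat rw [Finset.sum_insert (by decide)]
  rw [Finset.sum_singleton]
  simp only [add_assoc]

lemma sum_opposite_edge {M : Type*} [AddCommMonoid M] (s : Face) (b : Edge)
    (hb : ∀ e : Edge, (e.1.1 ∉ ({s.1.1, s.1.2.1, s.1.2.2} : Finset (Fin 5)) ∧
        e.1.2 ∉ ({s.1.1, s.1.2.1, s.1.2.2} : Finset (Fin 5))) ↔ e = b) (f : Edge → M) :
    (∑ e : Edge with e.1.1 ∉ ({s.1.1, s.1.2.1, s.1.2.2} : Finset (Fin 5)) ∧
        e.1.2 ∉ ({s.1.1, s.1.2.1, s.1.2.2} : Finset (Fin 5)), f e) = f b := by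
  simp only [hb, Finset.filter_eq', Finset.mem_univ, if_true, Finset.sum_singleton]

lemma quadraticForm_eq_matrixForm (φ : Face → ℂ) :
    quadraticForm φ = matrixForm fun i j => weightMatrix φ i j := by
  rw [quadraticForm, sum_face, matrixForm_eq]
  rw [sum_opposite_edge (face 0 1 2) (edge 3 4) (by decide),
    sum_opposite_edge (face 0 1 3) (edge 2 4) (by decide),
    sum_opposite_edge (face 0 1 4) (edge 2 3) (by decide),
    sum_opposite_edge (face 0 2 3) (edge 1 4) (by decide),
    sum_opposite_edge (face 0 2 4) (edge 1 3) (by decide),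
    sum_opposite_edge (face 0 3 4) (edge 1 2) (by decide),
    sum_opposite_edge (face 1 2 3) (edge 0 4) (by decide),
    sum_opposite_edge (face 1 2 4) (edge 0 3) (by decide),
    sum_opposite_edge (face 1 3 4) (edge 0 2) (by decide),
    sum_opposite_edge (face 2 3 4) (edge 0 1) (by decide)]
  have e012 : permSign ![3, 0, 1, 2, 4] = -1 := by decide
  have e013 : permSign ![2, 0, 1, 3, 4] = 1 := by decide
  have e014 : permSign ![2, 0, 1, 4, 3] = -1 := by decide
  have e023 : permSign ![1, 0, 2, 3, 4] = -1 := by decide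
  have e024 : permSign ![1, 0, 2, 4, 3] = 1 := by decide
  have e034 : permSign ![1, 0, 3, 4, 2] = -1 := by decide
  have e123 : permSign ![0, 1, 2, 3, 4] = 1 := by decide
  have e124 : permSign ![0, 1, 2, 4, 3] = -1 := by decide
  have e134 : permSign ![0, 1, 3, 4, 2] = 1 := by decide
  have e234 : permSign ![0, 2, 3, 4, 1] = -1 := by decide
  simp [edge, face, weightMatrix, e012, e013, e014, e023, e024, e034, e123, e124, e134, e234]
  abel

/-- The coefficients `φ` with a given skew-symmetric matrix. -/
lemma exists_weightMatrix_eq {F : Fin 5 → Fin 5 → ℂ} (hF : ∀ i j, F j i = -F i j) :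
    ∃ φ : Face → ℂ, ∀ i j, weightMatrix φ i j = F i j := by
  have hself : ∀ i, F i i = 0 := fun i => self_eq_neg.1 (hF i i)
  have hlt : ∀ {i j : Fin 5}, i < j → F j i = -F i j := fun {i j} _ => hF i j
  refine ⟨fun s => if s = face 2 3 4 then -F 0 1 else if s = face 1 3 4 then F 0 2 else
    if s = face 1 2 4 then -F 0 3 else if s = face 1 2 3 then F 0 4 else
    if s = face 0 3 4 then -F 1 2 else if s = face 0 2 4 then F 1 3 else
    if s = face 0 2 3 then -F 1 4 else if s = face 0 1 4 then -F 2 3 else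
    if s = face 0 1 3 then F 2 4 else -F 3 4, ?_⟩
  intro i j
  fin_cases i <;> fin_cases j <;> simp [weightMatrix, face, hself, hlt]

end EllipticWeight

end

theorem mainTheorem8 (τ : ℂ) (hτ : 0 < τ.im) (x : Fin 5 → ℂ)
    (hx : ∀ i j : Fin 5, i ≠ j →
      EllipticWeight.IsRegularPoint τ (x i - x j) ∧ EllipticWeight.sn τ (x i - x j) ≠ 0) :
    (∀ i j : Fin 5, EllipticWeight.IsRegularPoint τ ((x i - x j) / 2) ∧
      EllipticWeight.cn τ ((x i - x j) / 2) ≠ 0 ∧ EllipticWeight.dn τ ((x i - x j) / 2) ≠ 0) ∧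
    ∃ φ : EllipticWeight.Face → ℂ,
      (∀ i j : Fin 5, EllipticWeight.weightMatrix φ i j =
        EllipticWeight.sn τ ((x i - x j) / 2) /
          (EllipticWeight.cn τ ((x i - x j) / 2) * EllipticWeight.dn τ ((x i - x j) / 2))) ∧
      EllipticWeight.IsCocycleOfWeight (EllipticWeight.gaussianWeight φ)
        (EllipticWeight.ellipticCocycle τ x) := by
  refine ⟨EllipticWeight.regular_half hτ hx, ?_⟩
  obtain ⟨K, c, h⟩ := EllipticWeight.exists_edgeData hτ hx
  obtain ⟨φ, hφ⟩ := EllipticWeight.exists_weightMatrix_eq h.F_swap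
  refine ⟨φ, hφ, ?_⟩
  have hW := h.isCocycleOfWeight (EllipticWeight.isQuasiGaussianWeight_exp h.F_swap)
  have hF : EllipticWeight.quadraticForm φ =
      EllipticWeight.matrixForm (EllipticWeight.ellipticMatrix τ x) := by
    rw [EllipticWeight.quadraticForm_eq_matrixForm]
    congr 1
    funext i j
    exact hφ i j
  simp only [inv_inv, ← hF] at hW
  exact hW
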